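/- Let $k\ge 2$ and $b\ge 3$ be integers, and let $K\subseteq[0,1]$ be the set of real numbers having a base-$b$ expansion $\sum_{i\ge1}d_ib^{-i}$ with all digits $d_i\in\{0,1\}$. For a function $\Psi$ from the positive integers to $\mathbb{R}$, let $\mathcal{K}_k(\Psi)$ be the set of real numbers $\zeta$, not algebraic of degree $\le k$, such that $\max_{1\le j\le k}|\zeta^jq-p_j|\le\Psi(q)$ holds for infinitely many $(q,p_1,\dots,p_k)\in\mathbb{Z}_{\geq 1}\times\mathbb{Z}^k$, and let $\mathcal{K}_k^*(\Psi)$ be defined in the same way, counting only vectors with $\gcd(q,p_1,\dots,p_k)=1$. Let $\Psi$ take positive values, and assume (A3) there is $\hat x$ such that $\Psi(x)<\frac1{2x}$ for all integers $x\ge\hat x$, $x\geq 1$; (B2) $\Psi(lx)\le l\,\Psi(x)$ for all positive integers $l,x$. Then the set $$\Bigl(\mathcal{K}_k(\Psi)\setminus\bigcup_{c<1/(b-1)}\mathcal{K}_k(c\Psi)\Bigr)\cap K$$ is uncountable. The set obtained by replacing $\mathcal{K}_k$ with $\mathcal{K}_k^*$ throughout is also uncountable, and for this (B2) is not needed. Moreover,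 elements of these sets can be effectively constructed: there is an algorithm (depending only on $k$ and $b$) which, given as input a number $\hat x$ as in (A3), arbitrarily good dyadic approximations to the values $\Psi(q)$ as an oracle, and an arbitrary infinite binary sequence $\varepsilon$ as an oracle, computes a base-$b$ digit sequence, with digits in $\{0,1\}$, of a number $\zeta_\varepsilon$ that belongs to the second set (assuming (A3)) and, if (B2) holds, to the first one as well; for the same $\hat x$ and the same approximations, different $\varepsilon$ give different $\zeta_\varepsilon$. -/

import Mathlib

/-- Real numbers that are not algebraic of degree at most `k`. -/
def NotAlgebraicOfDegreeLE (k : ℕ) : Set ℝ :=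
  {ζ | ¬ (IsAlgebraic ℚ ζ ∧ (minpoly ℚ ζ).natDegree ≤ k)}

/-- The vectors `(q, p₁, …, p_k)` with `q ≥ 1` and `|ζ ^ j * q - p_j| ≤ Ψ q` for `1 ≤ j ≤ k`
(the index `j : Fin k` stands for the exponent `j + 1`). -/
def powerApproximations (k : ℕ) (Ψ : ℕ → ℝ) (ζ : ℝ) : Set (ℕ × (Fin k → ℤ)) :=
  {v | 0 < v.1 ∧ ∀ j : Fin k, |ζ ^ ((j : ℕ) + 1) * (v.1 : ℝ) - (v.2 j : ℝ)| ≤ Ψ v.1}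

/-- The coordinates `q, p₁, …, p_k` have no common divisor other than `1`. -/
def IsPrimitiveVector {k : ℕ} (v : ℕ × (Fin k → ℤ)) : Prop :=
  ∀ d : ℕ, d ∣ v.1 → (∀ j, (d : ℤ) ∣ v.2 j) → d = 1

/-- The set `𝒦_k(Ψ)`. -/
def approxSet (k : ℕ) (Ψ : ℕ → ℝ) : Set ℝ :=
  {ζ | ζ ∈ NotAlgebraicOfDegreeLE k ∧ (powerApproximations k Ψ ζ).Infinite}

/-- The set `𝒦_k^*(Ψ)`: only primitive vectors are counted. -/
def approxSetStar (k : ℕ) (Ψ : ℕ → ℝ) : Set ℝ :=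
  {ζ | ζ ∈ NotAlgebraicOfDegreeLE k ∧
    {v | v ∈ powerApproximations k Ψ ζ ∧ IsPrimitiveVector v}.Infinite}

/-- The numbers in `[0, 1]` having a base `b` expansion `∑ d_i b ^ (-i-1)` all of whose digits
belong to `J`. -/
def missingDigitSet (b : ℕ) (J : Set ℕ) : Set ℝ :=
  {ζ | ∃ d : ℕ → Fin b, (∀ i, (d i : ℕ) ∈ J) ∧ ζ = Real.ofDigits d}

/-- For `𝒦 = 𝒦_k` or `𝒦 = 𝒦_k^*`: the set `(𝒦(Ψ) \ ⋃_{c < 1/(b-1)} 𝒦(cΨ)) ∩ K_{{0,1}}`. -/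
def fractalExactSet (b : ℕ) (𝒦 : (ℕ → ℝ) → Set ℝ) (Ψ : ℕ → ℝ) : Set ℝ :=
  (𝒦 Ψ \ ⋃ (c : ℝ) (_ : c < 1 / ((b : ℝ) - 1)), 𝒦 (fun q => c * Ψ q)) ∩
    missingDigitSet b {0, 1}

/-- `Ψ` takes positive values on the positive integers. -/
def PositiveOnPos (Ψ : ℕ → ℝ) : Prop := ∀ q : ℕ, 0 < q → 0 < Ψ q

/-- `Ψ x < (1/2) x⁻¹` for all positive integers `x ≥ x₀`. -/
def HalfDecayFrom (Ψ : ℕ → ℝ) (x₀ : ℕ) : Prop :=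
  ∀ x : ℕ, 0 < x → x₀ ≤ x → Ψ x < (1 / 2) * (x : ℝ)⁻¹

/-- `Ψ (l x) ≤ l Ψ x` for all positive integers `l`, `x`. -/
def SubMultiplicativeGrowth (Ψ : ℕ → ℝ) : Prop :=
  ∀ l x : ℕ, 0 < l → 0 < x → Ψ (l * x) ≤ (l : ℝ) * Ψ x

/-- `α` presents `Ψ` through rational approximations: the value of `α` at the code of `(q, m)` is
the numerator of a dyadic fraction of denominator `2 ^ m` within `2 ^ (-m)` of `Ψ q`. -/
def IsNameOf (α : ℕ → ℕ) (Ψ : ℕ → ℝ) : Prop :=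
  ∀ q m : ℕ, 0 < q → |Ψ q - (α (Nat.pair q m) : ℝ) / 2 ^ m| ≤ 1 / 2 ^ m

/-- The first `m` terms of a sequence. -/
def seqPrefix {β : Type} (s : ℕ → β) (m : ℕ) : List β := (List.range m).map s

/-- `F` is a procedure working on an infinite input `(α, ε)` and a number `x₀`. Asked for the
`i`-th output digit, it reads longer and longer initial segments of `α` and `ε`; on each of them it
either answers `some v` or, with `none`, asks for more. `ProducesDigits F α ε x₀ d` says that
for every `i` it eventually answers, and that its answer is always `d i`. For a computable `F` this
is computation of `d` from `x₀` by a machine with oracles `α` and `ε`. -/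
def ProducesDigits (F : List ℕ × List Bool × ℕ × ℕ → Option ℕ)
    (α : ℕ → ℕ) (ε : ℕ → Bool) (x₀ : ℕ) (d : ℕ → ℕ) : Prop :=
  ∀ i : ℕ,
    (∃ m : ℕ, F (seqPrefix α m, seqPrefix ε m, x₀, i) = some (d i)) ∧
    ∀ m v : ℕ, F (seqPrefix α m, seqPrefix ε m, x₀, i) = some v → v = d i

/-! The number `ζ` is built from truncations `x_N = a_N / b ^ n_N` in lowest terms, whose tails `τ_N
= ζ - x_N` are steered against `ψ_N = Ψ q / q` at `q = b ^ (k * n_N)`. Let `r` be the least exponent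
with `b⁻ʳ + b⁻²ʳ ≤ ψ_N`, up to rounding. The next digits are zeros, a one at position `r - 1`, and
`r` equal digits `e`. With `e = 0` the tail is about `b⁻ʳ`, which is always allowed; with `e = 1` it
is about `b¹⁻ʳ / (b - 1)`, which is chosen only if `ψ_N` is at least that large. Minimality gives
`ψ_N ≲ b¹⁻ʳ`, so `e = 1` loses at most a factor `b - 1`; for `e = 0` the loss is at most about `b /
(b - 1) ≤ b - 1`. A free digit taken from `ε` and a final one, which keeps the numerator coprime to
`b`, close the block (`block_estimates`).

Since `ζ ≤ 1/4`, the powers of `x_N` with common denominator `q` approximate those of `ζ` within `Ψ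
q`. By (A3), `τ_N < b ^ (-2 * k * n_N) / 2`, so Liouville's inequality excludes degree at most `k`.

Conversely, an approximation within `c * Ψ`, where `c < 1 / (b - 1)`, has coordinates forming a
geometric progression `q, q x, q x², …` (`eq_pow_mul_of_powerApproximations`). Hence `x.den ^ k ∣
q`, and this makes `x` so good an approximation that it must be some `x_N` (`exists_eq_convergent`).
Then `q` is a multiple `m * b ^ (k * n_N)`; primitivity (`m = 1`) or (B2) reduces to `m = 1`, where
`τ_N ≤ c * ψ_N` contradicts the choice of the block for large `N`.

All choices are comparisons of integers made with rounded values of `Ψ`, so the digits are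
computable; each bit of `ε` is a digit, and expansions with digits 0, 1 are unique, so distinct `ε`
give distinct numbers. -/

/-! ### Truncations and tails of 0, 1 expansions -/

/-- The integer with base `b` digits `d 0, …, d (n - 1)`, leading digit first. -/
def prefixNum (b : ℕ) (d : ℕ → ℕ) : ℕ → ℕ
  | 0 => 0
  | n + 1 => b * prefixNum b d n + d n

theorem prefixNum_add_of_zero {b : ℕ} {d : ℕ → ℕ} {n : ℕ} (j : ℕ)
    (h : ∀ i, n ≤ i → i < n + j → d i = 0) :
    prefixNum b d (n + j) = b ^ j * prefixNum b d n := by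
  induction j with
  | zero => simp
  | succ j ih =>
    rw [← add_assoc, prefixNum, ih fun i h1 h2 => h i h1 (by omega), h (n + j) (by omega) (by omega)]
    ring

/-- Appending a digit one multiplies `(b - 1) * P + 1` by `b`. -/
theorem prefixNum_add_of_one {b : ℕ} {d : ℕ → ℕ} {n : ℕ} (j : ℕ)
    (h : ∀ i, n ≤ i → i < n + j → d i = 1) :
    ((b : ℝ) - 1) * prefixNum b d (n + j) + 1 = b ^ j * (((b : ℝ) - 1) * prefixNum b d n + 1) := by
  induction j with
  | zero => simp
  | succ j ih =>
    have ih := ih fun i h1 h2 => h i h1 (by omega)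
    rw [← add_assoc, prefixNum, h (n + j) (by omega) (by omega), pow_succ']
    push_cast
    linear_combination (b : ℝ) * ih

theorem coprime_prefixNum_succ {b : ℕ} {d : ℕ → ℕ} {n : ℕ} (h : d n = 1) :
    Nat.Coprime (prefixNum b d (n + 1)) b := by
  simp [prefixNum, h]

theorem sum_ofDigitsTerm_eq_prefixNum {b : ℕ} (hb : 0 < b) (d : ℕ → Fin b) (n : ℕ) :
    ∑ i ∈ Finset.range n, Real.ofDigitsTerm d i
      = (prefixNum b (fun i => (d i : ℕ)) n : ℝ) / (b : ℝ) ^ n := by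
  have hb' : (0 : ℝ) < b := by exact_mod_cast hb
  induction n with
  | zero => simp [prefixNum]
  | succ n ih =>
    rw [Finset.sum_range_succ, ih, prefixNum, Real.ofDigitsTerm]
    push_cast
    field_simp
    ring

theorem ofDigits_le_of_le_one {b : ℕ} (hb : 3 ≤ b) {d : ℕ → Fin b} (hd : ∀ i, (d i : ℕ) ≤ 1) :
    Real.ofDigits d ≤ 1 / ((b : ℝ) - 1) := by
  have hb' : (3 : ℝ) ≤ b := by exact_mod_cast hb
  have hs : HasSum (fun i : ℕ => ((b : ℝ) ^ (i + 1))⁻¹) (1 / ((b : ℝ) - 1)) := by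
    have h1 : (b : ℝ)⁻¹ < 1 := by
      rw [inv_lt_one_iff₀]
      right
      linarith
    have := (hasSum_geometric_of_lt_one (r := (b : ℝ)⁻¹) (by positivity) h1).mul_left (b : ℝ)⁻¹
    convert! this using 1
    · ext i
      rw [pow_succ', mul_inv, inv_pow]
    · have : (b : ℝ) - 1 ≠ 0 := by linarith
      field_simp
  rw [← hs.tsum_eq]
  refine Summable.tsum_mono Real.summable_ofDigitsTerm hs.summable fun i => ?_
  have : ((d i : ℕ) : ℝ) ≤ 1 := by exact_mod_cast hd i
  unfold Real.ofDigitsTerm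
  exact mul_le_of_le_one_left (by positivity) this

theorem prefixNum_div_le_ofDigits {b : ℕ} (hb : 3 ≤ b) (d : ℕ → Fin b) (n : ℕ) :
    (prefixNum b (fun i => (d i : ℕ)) n : ℝ) / (b : ℝ) ^ n ≤ Real.ofDigits d := by
  rw [Real.ofDigits_eq_sum_add_ofDigits d n, sum_ofDigitsTerm_eq_prefixNum (by omega)]
  have := Real.ofDigits_nonneg fun i => d (i + n)
  have : (0 : ℝ) ≤ ((b : ℝ) ^ n)⁻¹ * Real.ofDigits fun i => d (i + n) := by positivity
  linarith

theorem ofDigits_le_prefixNum_div {b : ℕ} (hb : 3 ≤ b) {d : ℕ → Fin b}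
    (hd : ∀ i, (d i : ℕ) ≤ 1) (n : ℕ) :
    Real.ofDigits d ≤ (prefixNum b (fun i => (d i : ℕ)) n : ℝ) / (b : ℝ) ^ n
      + 1 / (((b : ℝ) - 1) * (b : ℝ) ^ n) := by
  rw [Real.ofDigits_eq_sum_add_ofDigits d n, sum_ofDigitsTerm_eq_prefixNum (by omega)]
  have h := ofDigits_le_of_le_one hb (d := fun i => d (i + n)) fun i => hd _
  rw [← one_div_mul_one_div, mul_comm (1 / ((b : ℝ) - 1)), ← one_div ((b : ℝ) ^ n)]
  gcongr

/-- Digits at most 1 leave a tail of at most `1 / ((b - 1) * bⁿ)`, less than one unit of the `n`-th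
place because `b ≥ 3`. So the number determines every truncation. -/
theorem ofDigits_injOn_le_one {b : ℕ} (hb : 3 ≤ b) {d d' : ℕ → Fin b}
    (hd : ∀ i, (d i : ℕ) ≤ 1) (hd' : ∀ i, (d' i : ℕ) ≤ 1)
    (h : Real.ofDigits d = Real.ofDigits d') : d = d' := by
  have hb' : (3 : ℝ) ≤ b := by exact_mod_cast hb
  have key : ∀ {d d' : ℕ → Fin b}, (∀ i, (d i : ℕ) ≤ 1) → (∀ i, (d' i : ℕ) ≤ 1) →
      Real.ofDigits d = Real.ofDigits d' → ∀ n,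
      prefixNum b (fun i => (d i : ℕ)) n ≤ prefixNum b (fun i => (d' i : ℕ)) n := by
    intro d d' hd hd' h n
    have h1 := prefixNum_div_le_ofDigits hb d n
    have h2 := ofDigits_le_prefixNum_div hb hd' n
    rw [← h] at h2
    have h3 := h1.trans h2
    have hpos : (0 : ℝ) < (b : ℝ) ^ n := by positivity
    have h4 : 1 / (((b : ℝ) - 1) * (b : ℝ) ^ n) < 1 / (b : ℝ) ^ n := by
      apply one_div_lt_one_div_of_lt hpos
      nlinarith
    have h5 : (prefixNum b (fun i => (d i : ℕ)) n : ℝ) / (b : ℝ) ^ n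
        < ((prefixNum b (fun i => (d' i : ℕ)) n : ℝ) + 1) / (b : ℝ) ^ n := by
      rw [add_div]
      linarith
    rw [div_lt_div_iff_of_pos_right hpos] at h5
    have : prefixNum b (fun i => (d i : ℕ)) n < prefixNum b (fun i => (d' i : ℕ)) n + 1 := by
      exact_mod_cast h5
    omega
  have he : ∀ n, prefixNum b (fun i => (d i : ℕ)) n = prefixNum b (fun i => (d' i : ℕ)) n :=
    fun n => le_antisymm (key hd hd' h n) (key hd' hd h.symm n)
  funext i
  have h1 := he (i + 1)
  simp only [prefixNum, he i] at h1
  exact Fin.ext (by omega)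

/-- Estimates for the remainder of a `0, 1` expansion after `n` digits when the digits from `n` on
are zeros up to position `r`, a one, `r` digits equal to `e`, and then arbitrary. -/
theorem ofDigits_sub_prefixNum_bounds {b : ℕ} (hb : 3 ≤ b) {d : ℕ → Fin b}
    (hd : ∀ i, (d i : ℕ) ≤ 1) {n r e : ℕ} (hnr : n < r)
    (hzero : ∀ i, n ≤ i → i < r - 1 → (d i : ℕ) = 0) (hone : (d (r - 1) : ℕ) = 1)
    (hblock : ∀ i, r ≤ i → i < r + r → (d i : ℕ) = e) :
    1 / (b : ℝ) ^ r ≤ Real.ofDigits d - prefixNum b (fun i => (d i : ℕ)) n / (b : ℝ) ^ n ∧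
    Real.ofDigits d - prefixNum b (fun i => (d i : ℕ)) n / (b : ℝ) ^ n
      ≤ b / (b : ℝ) ^ r / ((b : ℝ) - 1) ∧
    (e = 0 → Real.ofDigits d - prefixNum b (fun i => (d i : ℕ)) n / (b : ℝ) ^ n
      ≤ 1 / (b : ℝ) ^ r + (1 / (b : ℝ) ^ r) ^ 2) ∧
    (e = 1 → b / (b : ℝ) ^ r * (1 - b / (b : ℝ) ^ r) ≤ ((b : ℝ) - 1) *
      (Real.ofDigits d - prefixNum b (fun i => (d i : ℕ)) n / (b : ℝ) ^ n)) := by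
  have hb' : (3 : ℝ) ≤ b := by exact_mod_cast hb
  obtain ⟨j, rfl⟩ : ∃ j, r = n + j + 1 := ⟨r - n - 1, by omega⟩
  simp only [Nat.add_sub_cancel] at hzero hone
  set P := prefixNum b (fun i => (d i : ℕ)) with hP
  have hz : P (n + j) = b ^ j * P n := prefixNum_add_of_zero j hzero
  have ho : P (n + j + 1) = b * P (n + j) + 1 := by rw [hP, prefixNum, hone]
  have hnj : (P (n + j) : ℝ) / (b : ℝ) ^ (n + j) = P n / (b : ℝ) ^ n := by
    rw [hz]
    push_cast
    rw [pow_add]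
    field_simp
  have hr : (P (n + j + 1) : ℝ) / (b : ℝ) ^ (n + j + 1) = P n / (b : ℝ) ^ n
      + 1 / (b : ℝ) ^ (n + j + 1) := by
    rw [← hnj, ho]
    push_cast
    rw [pow_succ]
    field_simp
  have hl := prefixNum_div_le_ofDigits hb d (n + j + 1)
  -- Truncating before the one, at `r - 1 = n + j`, gives the upper bound; truncating after it, as
  -- in `hl`, gives the lower one.
  have hu := ofDigits_le_prefixNum_div hb hd (n + j)
  rw [← hP] at hl hu
  refine ⟨by linarith, ?_, ?_, ?_⟩
  · rw [hnj] at hu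
    have : (b : ℝ) / (b : ℝ) ^ (n + j + 1) / ((b : ℝ) - 1)
        = 1 / (((b : ℝ) - 1) * (b : ℝ) ^ (n + j)) := by
      have : (b : ℝ) - 1 ≠ 0 := by linarith
      rw [pow_succ]
      field_simp
    rw [this]
    linarith
  · rintro rfl
    have h2 := ofDigits_le_prefixNum_div hb hd (n + j + 1 + (n + j + 1))
    rw [← hP] at h2
    have hz2 : P (n + j + 1 + (n + j + 1)) = b ^ (n + j + 1) * P (n + j + 1) :=
      prefixNum_add_of_zero _ hblock
    have h3 : (P (n + j + 1 + (n + j + 1)) : ℝ) / (b : ℝ) ^ (n + j + 1 + (n + j + 1))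
        = P (n + j + 1) / (b : ℝ) ^ (n + j + 1) := by
      rw [hz2, pow_add _ (n + j + 1) (n + j + 1)]
      push_cast
      field_simp
    rw [h3, hr] at h2
    have h4 : 1 / (((b : ℝ) - 1) * (b : ℝ) ^ (n + j + 1 + (n + j + 1)))
        ≤ (1 / (b : ℝ) ^ (n + j + 1)) ^ 2 := by
      rw [div_pow, one_pow, pow_add _ (n + j + 1) (n + j + 1), ← sq]
      apply one_div_le_one_div_of_le (by positivity)
      have : (0 : ℝ) < ((b : ℝ) ^ (n + j + 1)) ^ 2 := by positivity
      nlinarith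
    linarith
  · rintro rfl
    have h2 := prefixNum_div_le_ofDigits hb d (n + j + 1 + (n + j + 1))
    rw [← hP] at h2
    have h1 := prefixNum_add_of_one (b := b) (n + j + 1) hblock
    rw [← hP] at h1
    set X := (b : ℝ) ^ (n + j + 1) with hX
    have hXpos : 0 < X := by positivity
    rw [pow_add _ (n + j + 1) (n + j + 1), ← hX, div_le_iff₀ (by positivity)] at h2
    have hPr : (P (n + j + 1) : ℝ) = P n / (b : ℝ) ^ n * X + 1 := by
      have := hr
      field_simp at this
      field_simp
      linarith
    rw [hPr] at h1
    set ζ := Real.ofDigits d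
    set y := (P n : ℝ) / (b : ℝ) ^ n
    have e1 : (b : ℝ) / X * (1 - b / X) = b * (X - b) / (X * X) := by field_simp
    rw [e1, div_le_iff₀ (by positivity)]
    nlinarith

/-! ### Rigidity of approximations to powers -/

/-- If `ζ` is small, a vector approximating the powers of `ζ` well consists, up to the factor `q`,
of the powers of one rational number. -/
theorem eq_pow_mul_of_powerApproximations {k : ℕ} {Ψ : ℕ → ℝ} {ζ : ℝ} (hζ0 : 0 ≤ ζ)
    (hζ : ζ ≤ 1 / 4) {q : ℕ} {p : Fin k → ℤ} (hk : 0 < k)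
    (hv : (q, p) ∈ powerApproximations k Ψ ζ) (hΨ : Ψ q < 1 / 2 * (q : ℝ)⁻¹) (j : Fin k) :
    (p j : ℚ) = ((p ⟨0, hk⟩ : ℚ) / q) ^ ((j : ℕ) + 1) * q := by
  obtain ⟨hq, hp⟩ := hv
  simp only at hq hp
  have hqQ : (q : ℚ) ≠ 0 := by exact_mod_cast hq.ne'
  have hqR : (1 : ℝ) ≤ q := by exact_mod_cast hq
  have hΨq : q * Ψ q < 1 / 2 := by
    have := mul_lt_mul_of_pos_left hΨ (show (0 : ℝ) < q by linarith)
    field_simp at this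
    linarith
  have hΨ0 : 0 ≤ Ψ q := (abs_nonneg _).trans (hp ⟨0, hk⟩)
  have hΨ1 : Ψ q < 1 / 2 := by nlinarith
  -- The 2 × 2 minors of consecutive coordinates are integers; each is shown to be less than 1 in
  -- absolute value, hence zero.
  have step : ∀ i : ℕ, ∀ h : i + 1 < k,
      p ⟨i + 1, h⟩ * (q : ℤ) = p ⟨i, by omega⟩ * p ⟨0, hk⟩ := by
    intro i h
    have h0 := hp ⟨0, hk⟩
    have h1 := hp ⟨i, by omega⟩
    have h2 := hp ⟨i + 1, h⟩
    simp only [zero_add, pow_one] at h0 h1 h2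
    set P0 : ℝ := (p ⟨0, hk⟩ : ℝ)
    set P1 : ℝ := (p ⟨i, by omega⟩ : ℝ)
    set P2 : ℝ := (p ⟨i + 1, h⟩ : ℝ)
    have hpow0 : 0 ≤ ζ ^ (i + 1) := by positivity
    have hpow : ζ ^ (i + 1) ≤ 1 / 4 := by
      calc ζ ^ (i + 1) ≤ ζ ^ 1 := pow_le_pow_of_le_one hζ0 (by linarith) (by omega)
        _ ≤ 1 / 4 := by simpa using hζ
    have hP0 : |P0| ≤ q / 4 + Ψ q := by
      rw [abs_le] at h0 ⊢
      constructor <;> nlinarith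
    have e : P2 * q - P1 * P0 = -(q * (ζ ^ (i + 1 + 1) * q - P2))
        + (ζ ^ (i + 1) * (q * (ζ * q - P0)) + P0 * (ζ ^ (i + 1) * q - P1)) := by ring
    have hlt : |P2 * q - P1 * P0| < 1 := by
      rw [e]
      have a1 : |-(q * (ζ ^ (i + 1 + 1) * q - P2))| ≤ q * Ψ q := by
        rw [abs_neg, abs_mul, Nat.abs_cast]
        gcongr
      have a2 : |ζ ^ (i + 1) * (q * (ζ * q - P0))| ≤ 1 / 4 * (q * Ψ q) := by
        rw [abs_mul, abs_mul, Nat.abs_cast, abs_of_nonneg hpow0]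
        gcongr
      have a3 : |P0 * (ζ ^ (i + 1) * q - P1)| ≤ (q / 4 + Ψ q) * Ψ q := by
        rw [abs_mul]
        gcongr
      have := abs_add_le (-(q * (ζ ^ (i + 1 + 1) * q - P2)))
        (ζ ^ (i + 1) * (q * (ζ * q - P0)) + P0 * (ζ ^ (i + 1) * q - P1))
      have := abs_add_le (ζ ^ (i + 1) * (q * (ζ * q - P0))) (P0 * (ζ ^ (i + 1) * q - P1))
      nlinarith
    have hz : |p ⟨i + 1, h⟩ * (q : ℤ) - p ⟨i, by omega⟩ * p ⟨0, hk⟩| < 1 := by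
      simp only [P0, P1, P2] at hlt
      exact_mod_cast hlt
    rw [Int.abs_lt_one_iff] at hz
    linarith
  obtain ⟨j, hj⟩ := j
  induction j with
  | zero =>
    rw [zero_add, pow_one]
    field_simp
  | succ i ih =>
    have h1 := ih (by omega)
    have h2 : (p ⟨i + 1, hj⟩ : ℚ) * q = p ⟨i, by omega⟩ * p ⟨0, hk⟩ := by
      exact_mod_cast step i hj
    rw [h1] at h2
    apply mul_right_cancel₀ hqQ
    rw [h2]
    rw [pow_succ _ (i + 1)]
    field_simp

/-- Clearing denominators, `x.den ^ k` divides `x.num ^ k * q` and is coprime to the first factor.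
-/
theorem den_pow_dvd_of_eq_pow_mul {x : ℚ} {q k : ℕ} {p : ℤ} (h : (p : ℚ) = x ^ k * q) :
    x.den ^ k ∣ q := by
  have hd : (x.den : ℚ) ≠ 0 := by exact_mod_cast x.den_nz
  have h1 : p * (x.den : ℤ) ^ k = x.num ^ k * q := by
    have : (p : ℚ) * (x.den : ℚ) ^ k = (x.num : ℚ) ^ k * q := by
      have hx : x * x.den = x.num := Rat.mul_den_eq_num x
      rw [h, ← hx]
      ring
    exact_mod_cast this
  have h2 : ((x.den ^ k : ℕ) : ℤ) ∣ x.num ^ k * q := ⟨p, by rw [← h1]; push_cast; ring⟩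
  have h3 : IsCoprime ((x.den ^ k : ℕ) : ℤ) (x.num ^ k) := by
    push_cast
    apply IsCoprime.pow
    rw [Int.isCoprime_iff_gcd_eq_one, Int.gcd_comm]
    exact x.reduced
  exact_mod_cast h3.dvd_of_dvd_mul_left h2

theorem one_div_den_mul_den_le_abs_sub {x y : ℚ} (h : x ≠ y) :
    1 / ((x.den : ℝ) * y.den) ≤ |(x : ℝ) - y| := by
  have hx : (0 : ℝ) < x.den := by exact_mod_cast x.den_pos
  have hy : (0 : ℝ) < y.den := by exact_mod_cast y.den_pos
  have hne : x.num * (y.den : ℤ) - y.num * x.den ≠ 0 := by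
    intro h0
    exact h (Rat.eq_iff_mul_eq_mul.mpr (by linarith))
  have h1 : (1 : ℝ) ≤ |(x.num : ℝ) * y.den - y.num * x.den| := by
    exact_mod_cast Int.one_le_abs hne
  have e : (x : ℝ) - y = ((x.num : ℝ) * y.den - y.num * x.den) / (x.den * y.den) := by
    rw [Rat.cast_def x, Rat.cast_def y]
    field_simp
  rw [e, abs_div, abs_of_pos (mul_pos hx hy)]
  gcongr

theorem mul_eq_sub_mul_add_mul {j k : ℕ} (h : j < k) (n : ℕ) :
    k * n = (k - (j + 1)) * n + n * (j + 1) := by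
  obtain ⟨l, rfl⟩ := Nat.exists_eq_add_of_le (Nat.succ_le_of_lt h)
  simp only [Nat.succ_eq_add_one, Nat.add_sub_cancel_left]
  ring

/-! ### Consequences of sharp convergents -/

/-- A number `ζ` with convergents `a N / b ^ n N` approximating it to almost the precision that `Ψ`
allows, up to the factor `b - 1`. -/
structure HasSharpConvergents (k b : ℕ) (Ψ : ℕ → ℝ) (ζ : ℝ) (n r a : ℕ → ℕ) : Prop where
  le_n_zero : 11 ≤ n 0
  decay : HalfDecayFrom Ψ (b ^ (k * n 0))
  coprime : ∀ N, (a N).Coprime b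
  n_succ : ∀ N, n (N + 1) = r N + r N + 2
  lt_r : ∀ N, 2 * k * n N < r N
  lt_zeta : ∀ N, (a N : ℝ) / (b : ℝ) ^ n N < ζ
  tail_le : ∀ N, ζ - (a N : ℝ) / (b : ℝ) ^ n N ≤ Ψ (b ^ (k * n N)) / (b : ℝ) ^ (k * n N)
  tail_mul_le : ∀ N, (ζ - (a N : ℝ) / (b : ℝ) ^ n N) * (b : ℝ) ^ r N ≤ 2
  le_tail : ∀ N, Ψ (b ^ (k * n N)) / (b : ℝ) ^ (k * n N) * (1 - b / (b : ℝ) ^ r N)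
    ≤ ((b : ℝ) - 1) * (1 + 3 * (b / (b : ℝ) ^ r N)) * (ζ - (a N : ℝ) / (b : ℝ) ^ n N)
  zeta_le : ζ ≤ 1 / 4

namespace HasSharpConvergents

variable {k b : ℕ} {Ψ : ℕ → ℝ} {ζ : ℝ} {n r a : ℕ → ℕ}

theorem strictMono (H : HasSharpConvergents k b Ψ ζ n r a) (hk : 2 ≤ k) : StrictMono n := by
  apply strictMono_nat_of_lt_succ
  intro N
  have := H.lt_r N
  have : 1 * n N ≤ 2 * k * n N := Nat.mul_le_mul_right _ (by omega)
  rw [H.n_succ]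
  omega

theorem n_zero_le (H : HasSharpConvergents k b Ψ ζ n r a) (hk : 2 ≤ k) (N : ℕ) : n 0 ≤ n N :=
  (H.strictMono hk).monotone (Nat.zero_le N)

theorem zeta_pos (H : HasSharpConvergents k b Ψ ζ n r a) : 0 < ζ :=
  lt_of_le_of_lt (by positivity) (H.lt_zeta 0)

theorem den_eq (H : HasSharpConvergents k b Ψ ζ n r a) (hb : 3 ≤ b) (N : ℕ) :
    ((a N : ℚ) / (b : ℚ) ^ n N).den = b ^ n N := by
  have h := Rat.den_div_eq_of_coprime (a := (a N : ℤ)) (b := ((b ^ n N : ℕ) : ℤ))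
    (by positivity) (by simpa using Nat.Coprime.pow_right (n N) (H.coprime N))
  push_cast at h
  exact_mod_cast h

/-- The convergents approximate `ζ` to the order `2 * k`. -/
theorem tail_lt (H : HasSharpConvergents k b Ψ ζ n r a) (hk : 2 ≤ k) (hb : 3 ≤ b) (N : ℕ) :
    ζ - (a N : ℝ) / (b : ℝ) ^ n N < 1 / (2 * ((b : ℝ) ^ n N) ^ (2 * k)) := by
  have hb' : (0 : ℝ) < b := by exact_mod_cast (by omega : 0 < b)
  have h1 := H.decay (b ^ (k * n N)) (by positivity)
    (Nat.pow_le_pow_right (by omega) (Nat.mul_le_mul_left _ (H.n_zero_le hk N)))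
  have h2 := H.tail_le N
  push_cast at h1
  calc _ ≤ _ := h2
    _ < 1 / 2 * ((b : ℝ) ^ (k * n N))⁻¹ / (b : ℝ) ^ (k * n N) := by gcongr
    _ = _ := by
      rw [← pow_mul, show n N * (2 * k) = k * n N + k * n N by ring, pow_add]
      field_simp

theorem tail_lt_sq (H : HasSharpConvergents k b Ψ ζ n r a) (hk : 2 ≤ k) (hb : 3 ≤ b) (N : ℕ) :
    ζ - (a N : ℝ) / (b : ℝ) ^ n N < 1 / (2 * ((b : ℝ) ^ n N) ^ 2) := by
  have hb' : (1 : ℝ) ≤ b := by exact_mod_cast (by omega : 1 ≤ b)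
  refine (H.tail_lt hk hb N).trans_le ?_
  gcongr
  · exact one_le_pow₀ hb'
  · omega

/-- Every sufficiently good rational approximation of large denominator is a convergent. -/
theorem exists_eq_convergent (H : HasSharpConvergents k b Ψ ζ n r a) (hk : 2 ≤ k) (hb : 3 ≤ b)
    {M q : ℕ} {x : ℚ} (hq : b ^ n M < q) (hx : x.den ^ 2 ≤ q)
    (hlt : |ζ - x| < 1 / (2 * (q : ℝ) ^ 2)) :
    ∃ N, M ≤ N ∧ x = (a N : ℚ) / (b : ℚ) ^ n N := by
  have hb' : (3 : ℝ) ≤ b := by exact_mod_cast hb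
  set s := x.den with hs
  have hs0 : 0 < s := x.den_pos
  have hsR : (0 : ℝ) < s := by exact_mod_cast hs0
  have hsq : (s : ℝ) ^ 2 ≤ q := by exact_mod_cast hx
  have hqR : (0 : ℝ) < q := lt_of_lt_of_le (by positivity) hsq
  have hB0 : ∀ N, (0 : ℝ) < (b : ℝ) ^ n N := fun N => by positivity
  -- Two distinct fractions differ by at least the reciprocal of the product of their denominators.
  have sep : ∀ N, x ≠ (a N : ℚ) / (b : ℚ) ^ n N → 1 / ((s : ℝ) * (b : ℝ) ^ n N)
      < 1 / (2 * (q : ℝ) ^ 2) + (ζ - (a N : ℝ) / (b : ℝ) ^ n N) := by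
    intro N hne
    have h1 := one_div_den_mul_den_le_abs_sub hne
    rw [H.den_eq hb N] at h1
    push_cast at h1
    have h2 : |(x : ℝ) - (a N : ℝ) / (b : ℝ) ^ n N|
        ≤ |ζ - x| + |ζ - (a N : ℝ) / (b : ℝ) ^ n N| := by
      rw [abs_sub_comm ζ x]
      exact abs_sub_le _ _ _
    rw [abs_of_pos (sub_pos.mpr (H.lt_zeta N))] at h2
    linarith
  have hne : ∀ N, s ≠ b ^ n N → x ≠ (a N : ℚ) / (b : ℚ) ^ n N := by
    rintro N h rfl
    exact h (H.den_eq hb N)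
  -- With a smaller denominator, both `x` and the `M`-th convergent would lie within `1 / (2 * b ^
  -- (2 * n M))` of `ζ`, too close together for distinct fractions.
  have hM : b ^ n M ≤ s := by
    by_contra! hcon
    have h1 := sep M (hne M hcon.ne)
    have h2 := H.tail_lt_sq hk hb M
    have hcon' : (s : ℝ) ≤ (b : ℝ) ^ n M := by exact_mod_cast hcon.le
    have hq' : (b : ℝ) ^ n M ≤ q := by exact_mod_cast hq.le
    have h3 : 1 / (2 * (q : ℝ) ^ 2) ≤ 1 / (2 * ((b : ℝ) ^ n M) ^ 2) := by gcongr
    have h4 : 1 / ((b : ℝ) ^ n M * (b : ℝ) ^ n M) ≤ 1 / ((s : ℝ) * (b : ℝ) ^ n M) := by gcongr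
    have h5 : 1 / ((b : ℝ) ^ n M * (b : ℝ) ^ n M)
        = 1 / (2 * ((b : ℝ) ^ n M) ^ 2) + 1 / (2 * ((b : ℝ) ^ n M) ^ 2) := by
      field_simp
      norm_num
    linarith
  obtain ⟨N, hMN, hN1, hN2⟩ : ∃ N, M ≤ N ∧ b ^ n N ≤ s ∧ s < b ^ n (N + 1) := by
    have hex : ∃ N, s < b ^ n (N + 1) := by
      refine ⟨s, ?_⟩
      calc s < b ^ s := Nat.lt_pow_self (by omega)
        _ ≤ b ^ n (s + 1) := Nat.pow_le_pow_right (by omega)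
          ((Nat.le_succ s).trans (H.strictMono hk).le_apply)
    by_cases hc : Nat.find hex < M
    · have h1 := Nat.find_spec hex
      have h2 : b ^ n (Nat.find hex + 1) ≤ b ^ n M :=
        Nat.pow_le_pow_right (by omega) ((H.strictMono hk).monotone hc)
      omega
    · refine ⟨Nat.find hex, by omega, ?_, Nat.find_spec hex⟩
      rcases Nat.eq_zero_or_pos (Nat.find hex) with h0 | h0
      · rw [h0]
        rw [h0] at hc
        rwa [show M = 0 by omega] at hM
      · have := Nat.find_min hex (m := Nat.find hex - 1) (by omega)
        rw [Nat.sub_add_cancel h0] at this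
        omega
  refine ⟨N, hMN, ?_⟩
  by_contra hcon
  have hN1' : (b : ℝ) ^ n N ≤ s := by exact_mod_cast hN1
  have hN2' : (s : ℝ) ≤ (b : ℝ) ^ n (N + 1) := by exact_mod_cast hN2.le
  have hs1 : (1 : ℝ) ≤ s := by exact_mod_cast hs0
  have hqs : (s : ℝ) ^ 4 ≤ (q : ℝ) ^ 2 := by
    calc (s : ℝ) ^ 4 = ((s : ℝ) ^ 2) ^ 2 := by ring
      _ ≤ _ := by gcongr
  have h1 := sep N hcon
  have h2 := sep (N + 1) (hne _ hN2.ne)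
  -- Separation from the `N`-th convergent bounds `s` from below in terms of its tail; separation
  -- from the next one, in `h4`, bounds `s` from above.
  have h3 : 1 ≤ 2 * s * (b : ℝ) ^ n N * (ζ - (a N : ℝ) / (b : ℝ) ^ n N) := by
    have e1 : 1 / (2 * (q : ℝ) ^ 2) ≤ 1 / (2 * (s * (b : ℝ) ^ n N)) := by
      gcongr
      calc s * (b : ℝ) ^ n N ≤ s * s := by gcongr
        _ = (s : ℝ) ^ 2 := by ring
        _ ≤ (s : ℝ) ^ 4 := pow_le_pow_right₀ hs1 (by norm_num)
        _ ≤ _ := hqs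
    have e2 : 1 / (s * (b : ℝ) ^ n N)
        = 1 / (2 * (s * (b : ℝ) ^ n N)) + 1 / (2 * (s * (b : ℝ) ^ n N)) := by
      field_simp
      norm_num
    have e3 : 1 / (2 * (s * (b : ℝ) ^ n N)) ≤ ζ - (a N : ℝ) / (b : ℝ) ^ n N := by linarith
    rw [div_le_iff₀ (by have := hB0 N; positivity)] at e3
    linarith
  have h4 : (s : ℝ) ^ 3 ≤ (b : ℝ) ^ n (N + 1) := by
    have t := H.tail_lt_sq hk hb (N + 1)
    set B := (b : ℝ) ^ n (N + 1) with hB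
    have hBpos : 0 < B := hB0 _
    have e1 : 1 / (2 * B ^ 2) ≤ 1 / (2 * (s * B)) := by
      gcongr
      rw [sq]
      gcongr
    have e2 : 1 / (s * B) = 1 / (2 * (s * B)) + 1 / (2 * (s * B)) := by
      field_simp
      norm_num
    have e3 : 1 / (2 * (s * B)) < 1 / (2 * (q : ℝ) ^ 2) := by linarith
    have e4 : 2 * (q : ℝ) ^ 2 < 2 * (s * B) := by
      rwa [one_div_lt_one_div (by positivity) (by positivity)] at e3
    have e5 : s * (s : ℝ) ^ 3 ≤ s * B := by
      calc s * (s : ℝ) ^ 3 = (s : ℝ) ^ 4 := by ring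
        _ ≤ _ := hqs
        _ ≤ s * B := by linarith
    exact le_of_mul_le_mul_left e5 hsR
  have h5 : (b : ℝ) ^ r N ≤ 4 * s * (b : ℝ) ^ n N := by
    have t := H.tail_mul_le N
    have hr0 : (0 : ℝ) < (b : ℝ) ^ r N := by positivity
    have := mul_le_mul_of_nonneg_right h3 hr0.le
    have hsB : 0 ≤ 2 * s * (b : ℝ) ^ n N := by have := hB0 N; positivity
    nlinarith
  -- Eliminating `s` from `h5` and `h4` gives `3 * r < 4 + n (N + 1) + 3 * n N`. As `n (N + 1) = 2 *
  -- r + 2`, this means `r < 3 * n N + 6`, against `r > 2 * k * n N ≥ 4 * n N`.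
  have h6 : ((b : ℝ) ^ r N) ^ 3 < (b : ℝ) ^ (4 + n (N + 1) + 3 * n N) := by
    calc ((b : ℝ) ^ r N) ^ 3 ≤ (4 * s * (b : ℝ) ^ n N) ^ 3 := by gcongr
      _ = 64 * (s : ℝ) ^ 3 * ((b : ℝ) ^ n N) ^ 3 := by ring
      _ ≤ 64 * (b : ℝ) ^ n (N + 1) * ((b : ℝ) ^ n N) ^ 3 := by gcongr
      _ < 3 ^ 4 * (b : ℝ) ^ n (N + 1) * ((b : ℝ) ^ n N) ^ 3 := by
        have := hB0 N
        have := hB0 (N + 1)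
        gcongr
        norm_num
      _ ≤ (b : ℝ) ^ 4 * (b : ℝ) ^ n (N + 1) * ((b : ℝ) ^ n N) ^ 3 := by gcongr
      _ = _ := by rw [pow_add, pow_add, ← pow_mul, mul_comm 3]
  rw [← pow_mul, pow_lt_pow_iff_right₀ (by linarith), H.n_succ] at h6
  have h7 := H.lt_r N
  have h8 : 4 * n N ≤ 2 * k * n N := Nat.mul_le_mul_right _ (by omega)
  have h9 := H.n_zero_le hk N
  have := H.le_n_zero
  omega

theorem irrational (H : HasSharpConvergents k b Ψ ζ n r a) (hk : 2 ≤ k) (hb : 3 ≤ b) :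
    Irrational ζ := by
  rintro ⟨x, rfl⟩
  have hb' : (3 : ℝ) ≤ b := by exact_mod_cast hb
  set N := x.den with hN
  have hs : (1 : ℝ) ≤ x.den := by exact_mod_cast x.den_pos
  have hle : (x.den : ℝ) < (b : ℝ) ^ n N := by
    have : x.den < b ^ n N := (Nat.lt_pow_self (n := N) (by omega : 1 < b)).trans_le
      (Nat.pow_le_pow_right (by omega) (H.strictMono hk).le_apply)
    exact_mod_cast this
  have hne : x ≠ (a N : ℚ) / (b : ℚ) ^ n N := by
    intro h
    have := H.lt_zeta N
    rw [h] at this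
    push_cast at this
    exact lt_irrefl _ this
  have h1 := one_div_den_mul_den_le_abs_sub hne
  rw [H.den_eq hb N] at h1
  push_cast at h1
  rw [abs_of_pos (sub_pos.mpr (H.lt_zeta N))] at h1
  have h2 := H.tail_lt_sq hk hb N
  have h3 := h1.trans_lt h2
  rw [one_div_lt_one_div (by positivity) (by positivity)] at h3
  have : (x.den : ℝ) * (b : ℝ) ^ n N < ((b : ℝ) ^ n N) ^ 2 := by
    rw [sq]
    gcongr
  have : (0 : ℝ) < ((b : ℝ) ^ n N) ^ 2 := by positivity
  linarith

/-- Approximation to the order `2 * k` by infinitely many fractions contradicts Liouville's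
inequality for an integer polynomial of degree at most `k`. -/
theorem notAlgebraic (H : HasSharpConvergents k b Ψ ζ n r a) (hk : 2 ≤ k) (hb : 3 ≤ b) :
    ζ ∈ NotAlgebraicOfDegreeLE k := by
  rintro ⟨halg, hdeg⟩
  have hb' : (3 : ℝ) ≤ b := by exact_mod_cast hb
  set f := minpoly ℚ ζ with hf
  have hf0 : f ≠ 0 := minpoly.ne_zero halg.isIntegral
  set g := IsLocalization.integerNormalization (nonZeroDivisors ℤ) f with hg
  have hg0 : g ≠ 0 := by
    rw [hg, Ne, IsFractionRing.integerNormalization_eq_zero_iff]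
    exact hf0
  have hgdeg : g.natDegree ≤ k := by
    refine le_trans ?_ hdeg
    rw [Polynomial.natDegree_le_iff_coeff_eq_zero]
    intro i hi
    by_contra hcon
    have := IsLocalization.integerNormalization_support (nonZeroDivisors ℤ) f
      (Polynomial.mem_support_iff.mpr hcon)
    exact (Polynomial.mem_support_iff.mp this) (Polynomial.coeff_eq_zero_of_natDegree_lt hi)
  have hgz : Polynomial.eval ζ (g.map (algebraMap ℤ ℝ)) = 0 := by
    rw [Polynomial.eval_map_algebraMap, hg]
    exact IsLocalization.integerNormalization_aeval_eq_zero _ f (minpoly.aeval ℚ ζ)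
  obtain ⟨A, hA, hL⟩ := Liouville.exists_pos_real_of_irrational_root (H.irrational hk hb) hg0 hgz
  -- This index makes the denominator `B` exceed Liouville's constant `A`. Below, the denominator is
  -- entered as `b ^ n N - 1` because Liouville's inequality is stated with denominator `b + 1`.
  set N := ⌈A⌉₊ with hN
  have h1 := hL (a N) (b ^ n N - 1)
  have e : ((b ^ n N - 1 : ℕ) : ℝ) + 1 = (b : ℝ) ^ n N := by
    have : 1 ≤ b ^ n N := Nat.one_le_pow _ _ (by omega)
    push_cast [this]
    ring
  rw [e] at h1
  push_cast at h1
  rw [abs_of_pos (sub_pos.mpr (H.lt_zeta N))] at h1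
  have ht := H.tail_lt hk hb N
  set B := (b : ℝ) ^ n N with hB
  have hAB : A < B := by
    have h2 : N < b ^ n N := (Nat.lt_pow_self (n := N) (by omega : 1 < b)).trans_le
      (Nat.pow_le_pow_right (by omega) (H.strictMono hk).le_apply)
    have h3 : (N : ℝ) < B := by rw [hB]; exact_mod_cast h2
    exact (Nat.le_ceil A).trans_lt h3
  have hB1 : 1 ≤ B := one_le_pow₀ (by linarith)
  have h2 : B ^ g.natDegree * ((ζ - a N / B) * A)
      ≤ B ^ k * (1 / (2 * B ^ (2 * k)) * B) := by
    have := sub_pos.mpr (H.lt_zeta N)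
    gcongr
  have h3 : B ^ k * (1 / (2 * B ^ (2 * k)) * B) = B / B ^ k / 2 := by
    rw [two_mul k, pow_add]
    field_simp
  have h4 : B / B ^ k ≤ 1 := by
    rw [div_le_one (by positivity)]
    exact le_self_pow₀ hB1 (by omega)
  linarith

/-- The primitive integer vector attached to the `N`-th convergent. -/
theorem mem_powerApproximations (H : HasSharpConvergents k b Ψ ζ n r a) (hb : 3 ≤ b) (N : ℕ) :
    (b ^ (k * n N), fun j : Fin k => (a N : ℤ) ^ ((j : ℕ) + 1) *
      (b : ℤ) ^ ((k - ((j : ℕ) + 1)) * n N)) ∈ powerApproximations k Ψ ζ := by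
  have hb' : (3 : ℝ) ≤ b := by exact_mod_cast hb
  refine ⟨by positivity, fun j => ?_⟩
  set x := (a N : ℝ) / (b : ℝ) ^ n N with hx
  have hx0 : 0 ≤ x := by positivity
  have hxlt := H.lt_zeta N
  have hz := H.zeta_le
  have e : ((a N : ℝ) ^ ((j : ℕ) + 1) * (b : ℝ) ^ ((k - ((j : ℕ) + 1)) * n N))
      = x ^ ((j : ℕ) + 1) * (b : ℝ) ^ (k * n N) := by
    rw [mul_eq_sub_mul_add_mul j.2 (n N), pow_add (b : ℝ), hx, div_pow, pow_mul (b : ℝ) (n N)]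
    field_simp
  -- On `[0, 1/4]` taking powers does not increase distances, so the first power is the worst
  -- approximated.
  have hpow : ∀ i : ℕ, |ζ ^ (i + 1) - x ^ (i + 1)| ≤ ζ - x := by
    intro i
    rw [abs_of_nonneg (sub_nonneg.mpr (pow_le_pow_left₀ hx0 hxlt.le _))]
    induction i with
    | zero => simp
    | succ i ih =>
      have h1 : ζ ^ (i + 1) ≤ 1 / 4 := by
        calc ζ ^ (i + 1) ≤ ζ ^ 1 :=
            pow_le_pow_of_le_one H.zeta_pos.le (by linarith) (by omega)
          _ ≤ 1 / 4 := by simpa using hz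
      have h2 : 0 ≤ ζ ^ (i + 1) := pow_nonneg H.zeta_pos.le _
      have e2 : ζ ^ (i + 1 + 1) - x ^ (i + 1 + 1)
          = ζ ^ (i + 1) * (ζ - x) + x * (ζ ^ (i + 1) - x ^ (i + 1)) := by ring
      rw [e2]
      nlinarith [sub_pos.mpr hxlt]
  push_cast
  rw [e, ← sub_mul, abs_mul, abs_of_pos (show (0 : ℝ) < (b : ℝ) ^ (k * n N) by positivity)]
  have h := (hpow j).trans (H.tail_le N)
  rwa [le_div_iff₀ (by positivity)] at h

/-- The last coordinate is `a N ^ k`, which is coprime to the first, a power of `b`. -/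
theorem isPrimitiveVector (H : HasSharpConvergents k b Ψ ζ n r a) (hk : 2 ≤ k) (N : ℕ) :
    IsPrimitiveVector (b ^ (k * n N), fun j : Fin k => (a N : ℤ) ^ ((j : ℕ) + 1) *
      (b : ℤ) ^ ((k - ((j : ℕ) + 1)) * n N)) := by
  intro d h1 h2
  have h3 := h2 ⟨k - 1, by omega⟩
  simp only [Nat.sub_add_cancel (by omega : 1 ≤ k), Nat.sub_self, Nat.zero_mul, pow_zero,
    mul_one] at h1 h3
  have h4 : d ∣ a N ^ k := by exact_mod_cast h3
  exact Nat.eq_one_of_dvd_coprimes (Nat.Coprime.pow k (k * n N) (H.coprime N)) h4 h1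

theorem mem_approxSetStar (H : HasSharpConvergents k b Ψ ζ n r a) (hk : 2 ≤ k) (hb : 3 ≤ b) :
    ζ ∈ approxSetStar k Ψ := by
  refine ⟨H.notAlgebraic hk hb, ?_⟩
  refine Set.infinite_of_injective_forall_mem (f := fun N => (b ^ (k * n N),
    fun j : Fin k => (a N : ℤ) ^ ((j : ℕ) + 1) * (b : ℤ) ^ ((k - ((j : ℕ) + 1)) * n N))) ?_
    fun N => ⟨H.mem_powerApproximations hb N, H.isPrimitiveVector hk N⟩
  intro N N' h
  have h1 := congrArg Prod.fst h
  simp only at h1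
  have h2 := Nat.pow_right_injective (by omega : 2 ≤ b) h1
  exact (H.strictMono hk).injective (Nat.eq_of_mul_eq_mul_left (by omega) h2)

theorem mem_approxSet (H : HasSharpConvergents k b Ψ ζ n r a) (hk : 2 ≤ k) (hb : 3 ≤ b) :
    ζ ∈ approxSet k Ψ := by
  have h := H.mem_approxSetStar hk hb
  exact ⟨h.1, h.2.mono fun v hv => hv.1⟩

/-- No vector with a large first coordinate approximates to the precision `c * Ψ`. -/
theorem exists_bound_of_lt (H : HasSharpConvergents k b Ψ ζ n r a) (hk : 2 ≤ k) (hb : 3 ≤ b)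
    (hΨ : PositiveOnPos Ψ) {c : ℝ} (hc : c < 1 / ((b : ℝ) - 1)) :
    ∃ Q : ℕ, ∀ v ∈ powerApproximations k (fun q => c * Ψ q) ζ, Q < v.1 →
      ¬ (SubMultiplicativeGrowth Ψ ∨ IsPrimitiveVector v) := by
  have hb' : (3 : ℝ) ≤ b := by exact_mod_cast hb
  have hk0 : 0 < k := by omega
  -- The correction factors in `le_tail` tend to 1, so `c * (b - 1) < 1` eventually beats them.
  obtain ⟨M, hM⟩ : ∃ M, ∀ N, M ≤ N →
      c * (((b : ℝ) - 1) * (1 + 3 * (b / (b : ℝ) ^ r N))) < 1 - b / (b : ℝ) ^ r N := by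
    have ht : Filter.Tendsto (fun N => b / (b : ℝ) ^ r N) Filter.atTop (nhds 0) := by
      have h1 : Filter.Tendsto r Filter.atTop Filter.atTop := by
        refine Filter.tendsto_atTop_mono (fun N => ?_) Filter.tendsto_id
        have h2 := H.lt_r N
        have h3 := (H.strictMono hk).le_apply (x := N)
        have h4 : 1 * n N ≤ 2 * k * n N := Nat.mul_le_mul_right _ (by omega)
        simp only [id]
        omega
      exact Filter.Tendsto.const_div_atTop
        ((tendsto_pow_atTop_atTop_of_one_lt (by linarith)).comp h1) _
    have hl : Filter.Tendsto (fun N => c * (((b : ℝ) - 1) * (1 + 3 * (b / (b : ℝ) ^ r N))))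
        Filter.atTop (nhds (c * (((b : ℝ) - 1) * (1 + 3 * 0)))) :=
      ((tendsto_const_nhds.add (ht.const_mul 3)).const_mul _).const_mul _
    have hr : Filter.Tendsto (fun N => 1 - b / (b : ℝ) ^ r N) Filter.atTop (nhds (1 - 0)) :=
      tendsto_const_nhds.sub ht
    have hlt : c * (((b : ℝ) - 1) * (1 + 3 * 0)) < 1 - 0 := by
      rw [lt_div_iff₀ (by linarith)] at hc
      linarith
    obtain ⟨M, hM⟩ := Filter.eventually_atTop.mp (hl.eventually_lt hr hlt)
    exact ⟨M, hM⟩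
  -- The first bound brings (A3) into force; the second ensures that the convergent found has index
  -- at least `M`.
  refine ⟨max (b ^ (k * n 0)) (b ^ n M), ?_⟩
  rintro ⟨q, p⟩ hv hq
  obtain ⟨hq1, hq2⟩ := max_lt_iff.mp hq
  have hqpos : 0 < q := hv.1
  have hqR : (0 : ℝ) < q := by exact_mod_cast hqpos
  have hΨq : 0 < Ψ q := hΨ q hqpos
  have hv2 := hv.2
  simp only at hv2 hq1 hq2
  have hc0 : 0 ≤ c := by
    have := (abs_nonneg _).trans (hv2 ⟨0, hk0⟩)
    exact nonneg_of_mul_nonneg_left this hΨq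
  have hc1 : c ≤ 1 := by
    refine hc.le.trans ?_
    rw [div_le_one (by linarith)]
    linarith
  have hdec : c * Ψ q < 1 / 2 * (q : ℝ)⁻¹ :=
    lt_of_le_of_lt (mul_le_of_le_one_left hΨq.le hc1) (H.decay q hqpos hq1.le)
  set x : ℚ := (p ⟨0, hk0⟩ : ℚ) / q with hxdef
  have hpx : ∀ j : Fin k, (p j : ℚ) = x ^ ((j : ℕ) + 1) * q :=
    eq_pow_mul_of_powerApproximations H.zeta_pos.le H.zeta_le hk0 hv hdec
  have hdvd : x.den ^ k ∣ q := by
    have := hpx ⟨k - 1, by omega⟩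
    simp only [Nat.sub_add_cancel (by omega : 1 ≤ k)] at this
    exact den_pow_dvd_of_eq_pow_mul this
  have hζx : |ζ - x| * q ≤ c * Ψ q := by
    have h := hv2 ⟨0, hk0⟩
    simp only [zero_add, pow_one] at h
    have : (p ⟨0, hk0⟩ : ℝ) = x * q := by
      rw [hxdef]
      push_cast
      field_simp
    rwa [this, ← sub_mul, abs_mul, Nat.abs_cast] at h
  obtain ⟨N, hMN, hxN⟩ := H.exists_eq_convergent hk hb (x := x) hq2
    ((Nat.pow_le_pow_right x.den_pos hk).trans (Nat.le_of_dvd hqpos hdvd)) (by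
      have h := hζx.trans_lt hdec
      rw [← lt_div_iff₀ hqR] at h
      refine h.trans_eq ?_
      field_simp)
  have hxR : (x : ℝ) = (a N : ℝ) / (b : ℝ) ^ n N := by
    rw [hxN]
    push_cast
    rfl
  have hden : x.den ^ k = b ^ (k * n N) := by
    rw [hxN, H.den_eq hb N, ← pow_mul, mul_comm]
  rw [hden] at hdvd
  obtain ⟨m, hm⟩ := hdvd
  have hm0 : 0 < m := Nat.pos_of_ne_zero (by rintro rfl; omega)
  have hτ := sub_pos.mpr (H.lt_zeta N)
  rw [hxR, abs_of_pos hτ] at hζx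
  intro hor
  -- This is (B2) applied to `q = m * b ^ (k * n N)`; for a primitive vector `m = 1`, because `m`
  -- divides all coordinates.
  have hΨm : Ψ q ≤ m * Ψ (b ^ (k * n N)) := by
    rcases hor with hg | hprim
    · have := hg m (b ^ (k * n N)) hm0 (by positivity)
      rwa [mul_comm m, ← hm] at this
    · have h1 : m = 1 := by
        refine hprim m ⟨_, by rw [hm, mul_comm]⟩ fun j => ?_
        have h2 : (p j : ℚ) = ((m * (a N ^ ((j : ℕ) + 1)
            * b ^ ((k - ((j : ℕ) + 1)) * n N)) : ℕ) : ℚ) := by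
          have hbQ : (b : ℚ) ≠ 0 := by exact_mod_cast (by omega : b ≠ 0)
          rw [hpx j, hm, hxN, mul_eq_sub_mul_add_mul j.2 (n N), div_pow]
          push_cast
          rw [pow_add (b : ℚ), pow_mul (b : ℚ) (n N)]
          field_simp
        have h3 : p j = ((m * (a N ^ ((j : ℕ) + 1)
            * b ^ ((k - ((j : ℕ) + 1)) * n N)) : ℕ) : ℤ) := by exact_mod_cast h2
        simp only [h3]
        exact_mod_cast Dvd.intro _ rfl
      rw [hm, h1]
      simp
  have hmR : (0 : ℝ) < m := by exact_mod_cast hm0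
  have hBpos : (0 : ℝ) < (b : ℝ) ^ (k * n N) := by positivity
  have hqm : (q : ℝ) = (b : ℝ) ^ (k * n N) * m := by
    rw [hm]
    push_cast
    rfl
  set τ := ζ - (a N : ℝ) / (b : ℝ) ^ n N with hτdef
  set ψ := Ψ (b ^ (k * n N)) / (b : ℝ) ^ (k * n N) with hψdef
  have hψpos : 0 < ψ := div_pos (hΨ _ (by positivity)) hBpos
  have hτψ : τ ≤ c * ψ := by
    rw [hψdef, ← mul_div_assoc, le_div_iff₀ hBpos]
    have h1 : τ * q ≤ c * (m * Ψ (b ^ (k * n N))) :=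
      hζx.trans (mul_le_mul_of_nonneg_left hΨm hc0)
    rw [hqm] at h1
    have h2 : m * (τ * (b : ℝ) ^ (k * n N)) ≤ m * (c * Ψ (b ^ (k * n N))) := by linarith
    exact le_of_mul_le_mul_left h2 hmR
  have h1 := H.le_tail N
  have h2 := hM N hMN
  have h3 : (0 : ℝ) ≤ ((b : ℝ) - 1) * (1 + 3 * (b / (b : ℝ) ^ r N)) :=
    mul_nonneg (by linarith) (by positivity)
  have h4 := mul_le_mul_of_nonneg_left hτψ h3
  have h5 := mul_lt_mul_of_pos_left h2 hψpos
  linarith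

/-- Each `q` admits finitely many `p`, so infinitely many vectors force `q` to be unbounded. -/
theorem finite_powerApproximations_fst_le (ζ : ℝ) (k : ℕ) (Φ : ℕ → ℝ) (Q : ℕ) :
    {v : ℕ × (Fin k → ℤ) | v ∈ powerApproximations k Φ ζ ∧ v.1 ≤ Q}.Finite := by
  have : {v : ℕ × (Fin k → ℤ) | v ∈ powerApproximations k Φ ζ ∧ v.1 ≤ Q} ⊆
      ⋃ q ∈ Set.Iic Q, Prod.mk q '' Set.pi Set.univ fun j : Fin k =>
        Set.Icc ⌈ζ ^ ((j : ℕ) + 1) * q - Φ q⌉ ⌊ζ ^ ((j : ℕ) + 1) * q + Φ q⌋ := by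
    rintro ⟨q, p⟩ ⟨hv, hq⟩
    simp only [Set.mem_iUnion]
    refine ⟨q, hq, p, fun j _ => ?_, rfl⟩
    have := abs_le.mp (hv.2 j)
    simp only at this
    exact ⟨Int.ceil_le.mpr (by linarith), Int.le_floor.mpr (by linarith)⟩
  refine Set.Finite.subset ((Set.finite_Iic Q).biUnion fun q _ => Set.Finite.image _ ?_) this
  exact Set.Finite.pi fun j => Set.finite_Icc _ _

theorem notMem_approxSet (H : HasSharpConvergents k b Ψ ζ n r a) (hk : 2 ≤ k) (hb : 3 ≤ b)
    (hΨ : PositiveOnPos Ψ) (hg : SubMultiplicativeGrowth Ψ) {c : ℝ}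
    (hc : c < 1 / ((b : ℝ) - 1)) : ζ ∉ approxSet k (fun q => c * Ψ q) := by
  obtain ⟨Q, hQ⟩ := H.exists_bound_of_lt hk hb hΨ hc
  rintro ⟨-, hinf⟩
  refine hinf ((finite_powerApproximations_fst_le ζ k _ Q).subset fun v hv => ⟨hv, ?_⟩)
  by_contra! hlt
  exact hQ v hv hlt (Or.inl hg)

theorem notMem_approxSetStar (H : HasSharpConvergents k b Ψ ζ n r a) (hk : 2 ≤ k) (hb : 3 ≤ b)
    (hΨ : PositiveOnPos Ψ) {c : ℝ}
    (hc : c < 1 / ((b : ℝ) - 1)) : ζ ∉ approxSetStar k (fun q => c * Ψ q) := by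
  obtain ⟨Q, hQ⟩ := H.exists_bound_of_lt hk hb hΨ hc
  rintro ⟨-, hinf⟩
  refine hinf ((finite_powerApproximations_fst_le ζ k _ Q).subset fun v hv => ⟨hv.1, ?_⟩)
  by_contra! hlt
  exact hQ v hv.1 hlt (Or.inr hv.2)

end HasSharpConvergents

/-! ### Testing `Ψ` with finite precision -/

/-- The approximate value `a / 2 ^ (2 * b * r)` of `Ψ q`, where `q = b ^ (k * n)`, guarantees
`b ^ (-r) * (1 + b ^ (-r)) ≤ Ψ q / q`. -/
def Admissible (k b n r a : ℕ) : Prop :=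
  b ^ (k * n) * (b ^ r + 1) * 2 ^ (2 * b * r) + b ^ (2 * r) ≤ a * b ^ (2 * r)

/-- The approximate value `a / 2 ^ (2 * b * r)` of `Ψ q`, where `q = b ^ (k * n)`, guarantees
`b ^ (1 - r) / (b - 1) ≤ Ψ q / q`. -/
def AdmitsOnes (k b n r a : ℕ) : Prop :=
  b ^ (k * n) * b * 2 ^ (2 * b * r) + (b - 1) * b ^ r ≤ a * ((b - 1) * b ^ r)

instance (k b n r a : ℕ) : Decidable (Admissible k b n r a) :=
  inferInstanceAs (Decidable (_ ≤ _))

instance (k b n r a : ℕ) : Decidable (AdmitsOnes k b n r a) :=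
  inferInstanceAs (Decidable (_ ≤ _))

/-- Reading `2 * b * r` bits makes the rounding error at most `b⁻²ʳ`, of second order compared with
`b⁻ʳ`. -/
theorem one_div_two_pow_le {b : ℕ} (hb : 0 < b) (r : ℕ) : 1 / (2 : ℝ) ^ (2 * b * r) ≤ (1 / (b : ℝ) ^ r) ^ 2 := by
  have hb' : (0 : ℝ) < b := by exact_mod_cast hb
  rw [div_pow, one_pow, ← pow_mul]
  apply one_div_le_one_div_of_le (by positivity)
  have h : (b : ℝ) ≤ 2 ^ b := by exact_mod_cast (Nat.lt_two_pow_self (n := b)).le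
  calc (b : ℝ) ^ (r * 2) ≤ (2 ^ b) ^ (r * 2) := by gcongr
    _ = _ := by rw [← pow_mul]; ring_nf

section tests

variable {k b n r a : ℕ} {Ψ : ℕ → ℝ}

theorem le_of_admissible (hb : 3 ≤ b)
    (hΨ : |Ψ (b ^ (k * n)) - (a : ℝ) / 2 ^ (2 * b * r)| ≤ 1 / 2 ^ (2 * b * r))
    (h : Admissible k b n r a) :
    1 / (b : ℝ) ^ r + (1 / (b : ℝ) ^ r) ^ 2 ≤ Ψ (b ^ (k * n)) / (b : ℝ) ^ (k * n) := by
  have hb' : (0 : ℝ) < b := by exact_mod_cast (by omega : 0 < b)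
  have h' : (b : ℝ) ^ (k * n) * ((b : ℝ) ^ r + 1) * 2 ^ (2 * b * r) + (b : ℝ) ^ (2 * r)
      ≤ a * (b : ℝ) ^ (2 * r) := by exact_mod_cast h
  have h1 := (abs_le.mp hΨ).1
  rw [mul_comm 2 r, pow_mul (b : ℝ) r 2] at h'
  have hq : (0 : ℝ) < (b : ℝ) ^ (k * n) := by positivity
  have hT : (0 : ℝ) < 2 ^ (2 * b * r) := by positivity
  have hR : (0 : ℝ) < (b : ℝ) ^ r := by positivity
  set q := (b : ℝ) ^ (k * n)
  set T := (2 : ℝ) ^ (2 * b * r)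
  set R := (b : ℝ) ^ r
  have h2 : ((a : ℝ) - 1) / T ≤ Ψ (b ^ (k * n)) := by
    rw [sub_div]
    linarith
  rw [le_div_iff₀ hq]
  refine le_trans ?_ h2
  rw [le_div_iff₀ hT]
  have e : (1 / R + (1 / R) ^ 2) * q * T = q * (R + 1) * T / R ^ 2 := by field_simp
  rw [e, div_le_iff₀ (by positivity)]
  linarith

theorem le_of_not_admissible (hb : 3 ≤ b)
    (hΨ : |Ψ (b ^ (k * n)) - (a : ℝ) / 2 ^ (2 * b * r)| ≤ 1 / 2 ^ (2 * b * r))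
    (h : ¬ Admissible k b n r a) :
    Ψ (b ^ (k * n)) / (b : ℝ) ^ (k * n) ≤ 1 / (b : ℝ) ^ r * (1 + 3 * (1 / (b : ℝ) ^ r)) := by
  have hb' : (1 : ℝ) ≤ b := by exact_mod_cast (by omega : 1 ≤ b)
  have h' : a * (b : ℝ) ^ (2 * r) ≤
      (b : ℝ) ^ (k * n) * ((b : ℝ) ^ r + 1) * 2 ^ (2 * b * r) + (b : ℝ) ^ (2 * r) := by
    unfold Admissible at h
    push Not at h
    exact_mod_cast h.le
  have h1 := (abs_le.mp hΨ).2
  have h3 := one_div_two_pow_le (b := b) (by omega) r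
  rw [mul_comm 2 r, pow_mul (b : ℝ) r 2] at h'
  have hq : (1 : ℝ) ≤ (b : ℝ) ^ (k * n) := one_le_pow₀ hb'
  have hT : (0 : ℝ) < 2 ^ (2 * b * r) := by positivity
  have hR : (0 : ℝ) < (b : ℝ) ^ r := by positivity
  set q := (b : ℝ) ^ (k * n)
  set T := (2 : ℝ) ^ (2 * b * r)
  set R := (b : ℝ) ^ r
  have h2 : (a : ℝ) / T ≤ q * (1 / R + (1 / R) ^ 2) + 1 / T := by
    have e : q * (1 / R + (1 / R) ^ 2) + 1 / T = (q * (R + 1) * T + R ^ 2) / R ^ 2 / T := by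
      field_simp
    rw [e]
    gcongr
    rw [le_div_iff₀ (by positivity)]
    exact h'
  rw [div_le_iff₀ (by linarith)]
  have h4 : 0 ≤ (1 / R) ^ 2 := by positivity
  nlinarith

theorem le_of_admitsOnes (hb : 3 ≤ b)
    (hΨ : |Ψ (b ^ (k * n)) - (a : ℝ) / 2 ^ (2 * b * r)| ≤ 1 / 2 ^ (2 * b * r))
    (h : AdmitsOnes k b n r a) :
    b / (b : ℝ) ^ r / ((b : ℝ) - 1) ≤ Ψ (b ^ (k * n)) / (b : ℝ) ^ (k * n) := by
  have hb' : (3 : ℝ) ≤ b := by exact_mod_cast hb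
  have h' : (b : ℝ) ^ (k * n) * b * 2 ^ (2 * b * r) + ((b : ℝ) - 1) * (b : ℝ) ^ r
      ≤ a * (((b : ℝ) - 1) * (b : ℝ) ^ r) := by
    have := (Nat.cast_le (α := ℝ)).mpr h
    push_cast [Nat.cast_sub (by omega : 1 ≤ b)] at this
    exact this
  have h1 := (abs_le.mp hΨ).1
  have hq : (0 : ℝ) < (b : ℝ) ^ (k * n) := by positivity
  have hT : (0 : ℝ) < 2 ^ (2 * b * r) := by positivity
  have hR : (0 : ℝ) < (b : ℝ) ^ r := by positivity
  have hB : (0 : ℝ) < (b : ℝ) - 1 := by linarith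
  set q := (b : ℝ) ^ (k * n)
  set T := (2 : ℝ) ^ (2 * b * r)
  set R := (b : ℝ) ^ r
  have h2 : ((a : ℝ) - 1) / T ≤ Ψ (b ^ (k * n)) := by
    rw [sub_div]
    linarith
  rw [le_div_iff₀ hq]
  refine le_trans ?_ h2
  rw [le_div_iff₀ hT]
  have e : b / R / ((b : ℝ) - 1) * q * T = q * b * T / (((b : ℝ) - 1) * R) := by field_simp
  rw [e, div_le_iff₀ (by positivity)]
  linarith

theorem le_of_not_admitsOnes (hb : 3 ≤ b)
    (hΨ : |Ψ (b ^ (k * n)) - (a : ℝ) / 2 ^ (2 * b * r)| ≤ 1 / 2 ^ (2 * b * r))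
    (h : ¬ AdmitsOnes k b n r a) :
    Ψ (b ^ (k * n)) / (b : ℝ) ^ (k * n)
      ≤ b / (b : ℝ) ^ r / ((b : ℝ) - 1) + 2 * (1 / (b : ℝ) ^ r) ^ 2 := by
  have hb' : (3 : ℝ) ≤ b := by exact_mod_cast hb
  have h' : a * (((b : ℝ) - 1) * (b : ℝ) ^ r) ≤
      (b : ℝ) ^ (k * n) * b * 2 ^ (2 * b * r) + ((b : ℝ) - 1) * (b : ℝ) ^ r := by
    unfold AdmitsOnes at h
    push Not at h
    have := (Nat.cast_le (α := ℝ)).mpr h.le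
    push_cast [Nat.cast_sub (by omega : 1 ≤ b)] at this
    exact this
  have h1 := (abs_le.mp hΨ).2
  have h3 := one_div_two_pow_le (b := b) (by omega) r
  have hq : (1 : ℝ) ≤ (b : ℝ) ^ (k * n) := one_le_pow₀ (by linarith)
  have hT : (0 : ℝ) < 2 ^ (2 * b * r) := by positivity
  have hR : (0 : ℝ) < (b : ℝ) ^ r := by positivity
  have hB : (0 : ℝ) < (b : ℝ) - 1 := by linarith
  set q := (b : ℝ) ^ (k * n)
  set T := (2 : ℝ) ^ (2 * b * r)
  set R := (b : ℝ) ^ r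
  have h2 : (a : ℝ) / T ≤ q * (b / R / ((b : ℝ) - 1)) + 1 / T := by
    have e : q * (b / R / ((b : ℝ) - 1)) + 1 / T
        = (q * b * T + ((b : ℝ) - 1) * R) / (((b : ℝ) - 1) * R) / T := by
      field_simp
    rw [e]
    gcongr
    rw [le_div_iff₀ (by positivity)]
    exact h'
  rw [div_le_iff₀ (by linarith)]
  have h4 : 0 ≤ (1 / R) ^ 2 := by positivity
  nlinarith

/-- Admissibility and (A3) give `b⁻ʳ < Ψ q / q < q⁻²` with `q = b ^ (k * n)`. -/
theorem lt_of_admissible (hb : 3 ≤ b)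
    (hΨ : |Ψ (b ^ (k * n)) - (a : ℝ) / 2 ^ (2 * b * r)| ≤ 1 / 2 ^ (2 * b * r))
    (h : Admissible k b n r a)
    (hdec : Ψ (b ^ (k * n)) < 1 / 2 * (((b ^ (k * n) : ℕ) : ℝ))⁻¹) : 2 * k * n < r := by
  have hb' : (3 : ℝ) ≤ b := by exact_mod_cast hb
  have h1 := le_of_admissible hb hΨ h
  have hq : (0 : ℝ) < (b : ℝ) ^ (k * n) := by positivity
  have hR : (0 : ℝ) < (b : ℝ) ^ r := by positivity
  have h2 : 1 / (b : ℝ) ^ r < 1 / (b : ℝ) ^ (2 * k * n) := by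
    have e : 1 / (b : ℝ) ^ (2 * k * n) = ((b : ℝ) ^ (k * n))⁻¹ / (b : ℝ) ^ (k * n) := by
      rw [mul_assoc, two_mul, pow_add]
      field_simp
    have h3 : Ψ (b ^ (k * n)) / (b : ℝ) ^ (k * n)
        < ((b : ℝ) ^ (k * n))⁻¹ / (b : ℝ) ^ (k * n) := by
      gcongr
      push_cast at hdec
      have : 0 < ((b : ℝ) ^ (k * n))⁻¹ := by positivity
      linarith
    rw [e]
    have : 0 ≤ (1 / (b : ℝ) ^ r) ^ 2 := by positivity
    linarith
  rw [one_div_lt_one_div (by positivity) (by positivity)] at h2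
  exact (pow_lt_pow_iff_right₀ (by linarith)).mp h2

end tests

/-- If every test failed, `Ψ q / q ≤ 4 * b⁻ʳ` would hold for all `r`, against positivity. Hence the
search for `r` stops. -/
theorem exists_admissible {k b : ℕ} {Ψ : ℕ → ℝ} {α : ℕ → ℕ} (hb : 3 ≤ b) (hΨ : PositiveOnPos Ψ)
    (hα : IsNameOf α Ψ) (n : ℕ) :
    ∃ r, Admissible k b n r (α (Nat.pair (b ^ (k * n)) (2 * b * r))) := by
  by_contra! hcon
  have hb' : (3 : ℝ) ≤ b := by exact_mod_cast hb
  have hψ : 0 < Ψ (b ^ (k * n)) / (b : ℝ) ^ (k * n) :=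
    div_pos (hΨ _ (by positivity)) (by positivity)
  obtain ⟨r, hr⟩ := pow_unbounded_of_one_lt (4 / (Ψ (b ^ (k * n)) / (b : ℝ) ^ (k * n)))
    (by linarith : (1 : ℝ) < b)
  have h1 := le_of_not_admissible hb (hα _ (2 * b * r) (by positivity)) (hcon r)
  have h2 : 1 / (b : ℝ) ^ r ≤ 1 := by
    rw [div_le_one (by positivity)]
    exact one_le_pow₀ (by linarith)
  have h3 : 0 < 1 / (b : ℝ) ^ r := by positivity
  rw [div_lt_iff₀ hψ] at hr
  have h4 : (b : ℝ) ^ r * (1 / (b : ℝ) ^ r) = 1 := by field_simp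
  have h5 : (0 : ℝ) < (b : ℝ) ^ r := by positivity
  have h6 := mul_le_mul_of_nonneg_left h1 h5.le
  nlinarith

/-! ### The digits of one block -/

/-- The digit at position `i` of the block with leading one at position `r - 1`, continued by `r`
digits `e`, the digit `x` and a final one at position `2 * r + 1`. -/
def blockDigit (r e x i : ℕ) : ℕ :=
  if i < r - 1 then 0 else if i = r - 1 then 1 else if i < r + r then e
  else if i = r + r then x else 1

theorem blockDigit_le_one {r e x : ℕ} (he : e ≤ 1) (hx : x ≤ 1) (i : ℕ) :
    blockDigit r e x i ≤ 1 := by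
  unfold blockDigit
  split_ifs <;> omega

/-- The estimates for one block that enter `HasSharpConvergents`. -/
theorem block_estimates {k b n r : ℕ} {Ψ : ℕ → ℝ} {α : ℕ → ℕ} (hb : 3 ≤ b)
    (hα : IsNameOf α Ψ) {d : ℕ → Fin b} (hd : ∀ i, (d i : ℕ) ≤ 1) (hnr : n < r)
    (hadm : Admissible k b n r (α (Nat.pair (b ^ (k * n)) (2 * b * r))))
    (hnadm : ¬ Admissible k b n (r - 1) (α (Nat.pair (b ^ (k * n)) (2 * b * (r - 1)))))
    {x : ℕ} (hdig : ∀ i, n ≤ i → i < r + r + 2 → (d i : ℕ) = blockDigit r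
      (if AdmitsOnes k b n r (α (Nat.pair (b ^ (k * n)) (2 * b * r))) then 1 else 0) x i)
    {τ : ℝ} (hτ : τ = Real.ofDigits d - prefixNum b (fun i => (d i : ℕ)) n / (b : ℝ) ^ n) :
    0 < τ ∧ τ ≤ Ψ (b ^ (k * n)) / (b : ℝ) ^ (k * n) ∧ τ * (b : ℝ) ^ r ≤ 2 ∧
    Ψ (b ^ (k * n)) / (b : ℝ) ^ (k * n) * (1 - b / (b : ℝ) ^ r)
      ≤ ((b : ℝ) - 1) * (1 + 3 * (b / (b : ℝ) ^ r)) * τ := by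
  have hb' : (3 : ℝ) ≤ b := by exact_mod_cast hb
  have hname : ∀ r', |Ψ (b ^ (k * n)) - (α (Nat.pair (b ^ (k * n)) (2 * b * r')) : ℝ)
      / 2 ^ (2 * b * r')| ≤ 1 / 2 ^ (2 * b * r') := fun r' => hα _ _ (by positivity)
  have h1 := le_of_admissible hb (hname r) hadm
  have h2 := le_of_not_admissible hb (hname (r - 1)) hnadm
  set e := if AdmitsOnes k b n r (α (Nat.pair (b ^ (k * n)) (2 * b * r))) then 1 else 0 with he
  obtain ⟨t1, t2, t3, t4⟩ := ofDigits_sub_prefixNum_bounds hb hd (e := e) hnr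
    (fun i h1 h2 => by rw [hdig i h1 (by omega), blockDigit, if_pos h2])
    (by rw [hdig (r - 1) (by omega) (by omega), blockDigit, if_neg (by omega), if_pos rfl])
    (fun i h1 h2 => by
      rw [hdig i (by omega) (by omega), blockDigit, if_neg (by omega), if_neg (by omega),
        if_pos h2])
  rw [← hτ] at t1 t2 t3 t4
  have hR : (0 : ℝ) < (b : ℝ) ^ r := by positivity
  have hX : 1 / (b : ℝ) ^ (r - 1) = b / (b : ℝ) ^ r := by
    obtain ⟨j, rfl⟩ : ∃ j, r = j + 1 := ⟨r - 1, by omega⟩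
    rw [Nat.add_sub_cancel, pow_succ]
    field_simp
  have hX1 : b / (b : ℝ) ^ r ≤ 1 := by
    rw [← hX, div_le_one (by positivity)]
    exact one_le_pow₀ (by linarith)
  rw [hX] at h2
  set ψ := Ψ (b ^ (k * n)) / (b : ℝ) ^ (k * n)
  have hB : (0 : ℝ) < (b : ℝ) - 1 := by linarith
  have hy : 0 < 1 / (b : ℝ) ^ r := by positivity
  have hXy : b / (b : ℝ) ^ r = b * (1 / (b : ℝ) ^ r) := by ring
  have hX0 : 0 < b / (b : ℝ) ^ r := by positivity
  have hψ0 : 0 ≤ ψ := le_trans (by positivity) h1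
  refine ⟨hy.trans_le t1, ?_, ?_, ?_⟩
  · by_cases hc : AdmitsOnes k b n r (α (Nat.pair (b ^ (k * n)) (2 * b * r)))
    · exact t2.trans (le_of_admitsOnes hb (hname r) hc)
    · exact (t3 (by rw [he, if_neg hc])).trans h1
  · have : τ * (b : ℝ) ^ r ≤ b / (b : ℝ) ^ r / ((b : ℝ) - 1) * (b : ℝ) ^ r := by gcongr
    refine this.trans ?_
    rw [div_div, div_mul_eq_mul_div, div_le_iff₀ (by positivity)]
    nlinarith
  · by_cases hc : AdmitsOnes k b n r (α (Nat.pair (b ^ (k * n)) (2 * b * r)))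
    · have t5 := t4 (by rw [he, if_pos hc])
      set X := b / (b : ℝ) ^ r
      have h5 := mul_le_mul_of_nonneg_right h2 (sub_nonneg.mpr hX1)
      have h6 := mul_le_mul_of_nonneg_left t5 (show 0 ≤ 1 + 3 * X by linarith)
      linarith
    · have h5 := le_of_not_admitsOnes hb (hname r) hc
      have h6 : ψ * (1 - b / (b : ℝ) ^ r) ≤ ψ := mul_le_of_le_one_right hψ0 (by linarith)
      refine h6.trans (h5.trans ?_)
      rw [hXy]
      set y := 1 / (b : ℝ) ^ r
      -- Zeros were written: `τ ≥ y` and `ψ` is at most about `b * y / (b - 1)`. The inequality is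
      -- `b ≤ (b - 1) ^ 2`, true for `b ≥ 3`; the rounding error `2 * y ^ 2` is absorbed in `h9`.
      have h7 : b * y / ((b : ℝ) - 1) ≤ ((b : ℝ) - 1) * y := by
        rw [div_le_iff₀ hB]
        nlinarith [mul_pos hy hB]
      have h8 : ((b : ℝ) - 1) * (1 + 3 * (b * y)) * y
          ≤ ((b : ℝ) - 1) * (1 + 3 * (b * y)) * τ := by gcongr
      have h9 : 2 * y ^ 2 ≤ ((b : ℝ) - 1) * (3 * (b * y)) * y := by
        have : (2 : ℝ) ≤ ((b : ℝ) - 1) * (3 * b) := by nlinarith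
        nlinarith [sq_nonneg y]
      linarith

/-! ### The algorithm -/

/-- The digits from position `n` on that a successful test with the approximate value `a` adds. -/
def digitBlock (k b n r a : ℕ) (x : Bool) : List ℕ :=
  (List.range (r + r + 2 - n)).map fun i =>
    blockDigit r (if AdmitsOnes k b n r a then 1 else 0) x.toNat (n + i)

/-- The digits found, the number of bits of `ε` used, and the current value of `r`. -/
abbrev ExpansionState := List ℕ × ℕ × ℕ

/-- Starting from `r = 0` and raising it by one after each failure makes the accepted `r` the least
admissible one, as the lower bound on the tail requires. -/
def advance (k b : ℕ) (s : ExpansionState) (a : ℕ) (x : Bool) : ExpansionState :=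
  if Admissible k b s.1.length s.2.2 a then
    (s.1 ++ digitBlock k b s.1.length s.2.2 a x, s.2.1 + 1, 0)
  else (s.1, s.2.1, s.2.2 + 1)

/-- The position in the name of `Ψ` that is read in the given state. -/
def query (k b : ℕ) (s : ExpansionState) : ℕ := Nat.pair (b ^ (k * s.1.length)) (2 * b * s.2.2)

def oracleStep (k b : ℕ) (α : ℕ → ℕ) (ε : ℕ → Bool) (s : ExpansionState) : ExpansionState :=
  advance k b s (α (query k b s)) (ε s.2.1)

/-- The step on finite initial segments of the oracles; it does nothing if they are too short. -/
def finiteStep (k b : ℕ) (l : List ℕ) (e : List Bool) (s : ExpansionState) : ExpansionState :=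
  ((l[query k b s]?).bind fun a => (e[s.2.1]?).map fun x => advance k b s a x).getD s

/-- The length exceeds `x₀`, so (A3) applies from the first block on; the zeros keep `ζ` below
`1/4`, and the final one makes the first numerator coprime to `b`. -/
def initialState (x₀ : ℕ) : ExpansionState :=
  ((List.range (x₀ + 11)).map fun i => if i = x₀ + 10 then 1 else 0, 0, 0)

/-- The number of steps is the length of the initial segment read, so every computation is bounded
and the procedure is primitive recursive. -/
def digitProcedure (k b : ℕ) (p : List ℕ × List Bool × ℕ × ℕ) : Option ℕ :=
  ((finiteStep k b p.1 p.2.1)^[p.1.length] (initialState p.2.2.1)).1[p.2.2.2]?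

/-! ### Primitive recursiveness of the procedure -/

section computability

variable {β : Type} [Primcodable β] {f g : β → ℕ}

theorem Primrec.nat_add_apply (hf : Primrec f) (hg : Primrec g) : Primrec fun y => f y + g y :=
  Primrec.nat_add.comp hf hg

theorem Primrec.nat_mul_apply (hf : Primrec f) (hg : Primrec g) : Primrec fun y => f y * g y :=
  Primrec.nat_mul.comp hf hg

theorem Primrec.nat_sub_apply (hf : Primrec f) (hg : Primrec g) : Primrec fun y => f y - g y :=
  Primrec.nat_sub.comp hf hg

theorem Primrec.nat_pow_apply (hf : Primrec f) (hg : Primrec g) : Primrec fun y => f y ^ g y :=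
  (Primrec₂.unpaired'.1 Nat.Primrec.pow).comp hf hg

open Primrec

variable {n r a e x i : β → ℕ}

theorem primrecPred_admissible (k b : ℕ) (hn : Primrec n) (hr : Primrec r) (ha : Primrec a) :
    PrimrecPred fun y => Admissible k b (n y) (r y) (a y) :=
  nat_le.comp
    (nat_add_apply
      (nat_mul_apply
        (nat_mul_apply (nat_pow_apply (const b) (nat_mul_apply (const k) hn))
          (nat_add_apply (nat_pow_apply (const b) hr) (const 1)))
        (nat_pow_apply (const 2) (nat_mul_apply (const (2 * b)) hr)))
      (nat_pow_apply (const b) (nat_mul_apply (const 2) hr)))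
    (nat_mul_apply ha (nat_pow_apply (const b) (nat_mul_apply (const 2) hr)))

theorem primrecPred_admitsOnes (k b : ℕ) (hn : Primrec n) (hr : Primrec r) (ha : Primrec a) :
    PrimrecPred fun y => AdmitsOnes k b (n y) (r y) (a y) :=
  nat_le.comp
    (nat_add_apply
      (nat_mul_apply
        (nat_mul_apply (nat_pow_apply (const b) (nat_mul_apply (const k) hn)) (const b))
        (nat_pow_apply (const 2) (nat_mul_apply (const (2 * b)) hr)))
      (nat_mul_apply (const (b - 1)) (nat_pow_apply (const b) hr)))
    (nat_mul_apply ha (nat_mul_apply (const (b - 1)) (nat_pow_apply (const b) hr)))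

theorem primrec_blockDigit (hr : Primrec r) (he : Primrec e) (hx : Primrec x) (hi : Primrec i) :
    Primrec fun y => blockDigit (r y) (e y) (x y) (i y) :=
  ite (nat_lt.comp hi (nat_sub_apply hr (const 1))) (const 0)
    (ite (Primrec.eq.comp hi (nat_sub_apply hr (const 1))) (const 1)
      (ite (nat_lt.comp hi (nat_add_apply hr hr)) he
        (ite (Primrec.eq.comp hi (nat_add_apply hr hr)) hx (const 1))))

theorem primrec_digitBlock (k b : ℕ) (hn : Primrec n) (hr : Primrec r) (ha : Primrec a)
    {x : β → Bool} (hx : Primrec x) :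
    Primrec fun y => digitBlock k b (n y) (r y) (a y) (x y) :=
  list_map
    (list_range.comp (nat_sub_apply (nat_add_apply (nat_add_apply hr hr) (const 2)) hn))
    (primrec_blockDigit (hr.comp fst)
      ((ite (primrecPred_admitsOnes k b hn hr ha) (const 1) (const 0)).comp fst)
      ((dom_finite Bool.toNat).comp (hx.comp fst)) (nat_add_apply (hn.comp fst) snd)).to₂

theorem primrec_advance (k b : ℕ) {s : β → ExpansionState} (hs : Primrec s) (ha : Primrec a)
    {x : β → Bool} (hx : Primrec x) : Primrec fun y => advance k b (s y) (a y) (x y) := by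
  have hD : Primrec fun y => (s y).1 := fst.comp hs
  have hn : Primrec fun y => (s y).1.length := list_length.comp hD
  have hN : Primrec fun y => (s y).2.1 := fst.comp (snd.comp hs)
  have hr : Primrec fun y => (s y).2.2 := snd.comp (snd.comp hs)
  exact ite (primrecPred_admissible k b hn hr ha)
    (Primrec.pair (list_append.comp hD (primrec_digitBlock k b hn hr ha hx))
      (Primrec.pair (nat_add_apply hN (const 1)) (const 0)))
    (Primrec.pair hD (Primrec.pair hN (nat_add_apply hr (const 1))))

theorem primrec_query (k b : ℕ) : Primrec (query k b) :=
  Primrec₂.natPair.comp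
    (nat_pow_apply (const b) (nat_mul_apply (const k) (list_length.comp fst)))
    (nat_mul_apply (const (2 * b)) (snd.comp snd))

theorem primrec_finiteStep (k b : ℕ) {l : β → List ℕ} {e : β → List Bool}
    {s : β → ExpansionState} (hl : Primrec l) (he : Primrec e) (hs : Primrec s) :
    Primrec fun y => finiteStep k b (l y) (e y) (s y) := by
  refine option_getD.comp ?_ hs
  refine option_bind (list_getElem?.comp hl ((primrec_query k b).comp hs)) ?_
  refine option_map (list_getElem?.comp (he.comp fst) (fst.comp (snd.comp (hs.comp fst)))) ?_
  exact (primrec_advance k b (hs.comp (fst.comp fst)) (snd.comp fst) snd).to₂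

theorem primrec_initialState : Primrec initialState := by
  refine Primrec.pair (list_map (list_range.comp (nat_add_apply Primrec.id (const 11))) ?_)
    (const (0, 0))
  exact (ite (Primrec.eq.comp snd (nat_add_apply fst (const 10))) (const 1) (const 0)).to₂

theorem computable_digitProcedure (k b : ℕ) : Computable (digitProcedure k b) := by
  refine Primrec.to_comp (list_getElem?.comp (fst.comp ?_) (snd.comp (snd.comp snd)))
  refine nat_iterate (list_length.comp fst) (primrec_initialState.comp (fst.comp (snd.comp snd))) ?_
  exact (primrec_finiteStep k b (fst.comp fst) (fst.comp (snd.comp fst)) snd).to₂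

end computability

/-! ### Finite initial segments against full oracles -/

section correctness

variable (k b : ℕ) (α : ℕ → ℕ) (ε : ℕ → Bool)

theorem getElem?_seqPrefix {β : Type} (s : ℕ → β) (m i : ℕ) :
    (seqPrefix s m)[i]? = if i < m then some (s i) else none := by
  unfold seqPrefix
  split_ifs with h
  · simp [h]
  · simp [not_lt.mp h]

theorem length_seqPrefix {β : Type} (s : ℕ → β) (m : ℕ) : (seqPrefix s m).length = m := by
  simp [seqPrefix]

theorem finiteStep_eq_of_lt {m : ℕ} {s : ExpansionState} (h1 : query k b s < m) (h2 : s.2.1 < m) :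
    finiteStep k b (seqPrefix α m) (seqPrefix ε m) s = oracleStep k b α ε s := by
  simp [finiteStep, getElem?_seqPrefix, h1, h2, oracleStep]

theorem finiteStep_eq_or_eq (m : ℕ) (s : ExpansionState) :
    finiteStep k b (seqPrefix α m) (seqPrefix ε m) s = oracleStep k b α ε s ∨
    finiteStep k b (seqPrefix α m) (seqPrefix ε m) s = s := by
  by_cases h : query k b s < m ∧ s.2.1 < m
  · exact Or.inl (finiteStep_eq_of_lt k b α ε h.1 h.2)
  · right
    by_cases h1 : query k b s < m
    · have h2 : ¬ s.2.1 < m := fun h2 => h ⟨h1, h2⟩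
      simp [finiteStep, getElem?_seqPrefix, h2]
    · simp [finiteStep, getElem?_seqPrefix, h1]

/-- A step on finite segments either agrees with the oracle step or stalls. So a finite run only
reaches states of the oracle run, and its answers are never wrong. -/
theorem exists_iterate_finiteStep_eq (m : ℕ) (s : ExpansionState) (t : ℕ) :
    ∃ t', (finiteStep k b (seqPrefix α m) (seqPrefix ε m))^[t] s = (oracleStep k b α ε)^[t'] s := by
  induction t with
  | zero => exact ⟨0, rfl⟩
  | succ t ih =>
    obtain ⟨t', ht⟩ := ih
    rw [Function.iterate_succ_apply', ht]
    rcases finiteStep_eq_or_eq k b α ε m ((oracleStep k b α ε)^[t'] s) with h | h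
    · exact ⟨t' + 1, by rw [h, Function.iterate_succ_apply']⟩
    · exact ⟨t', h⟩

theorem exists_forall_iterate_finiteStep_eq (s : ExpansionState) (T : ℕ) :
    ∃ m₀, ∀ m, m₀ ≤ m →
      (finiteStep k b (seqPrefix α m) (seqPrefix ε m))^[T] s = (oracleStep k b α ε)^[T] s := by
  induction T with
  | zero => exact ⟨0, fun _ _ => rfl⟩
  | succ T ih =>
    obtain ⟨m₀, h⟩ := ih
    set u := (oracleStep k b α ε)^[T] s with hu
    refine ⟨m₀ + query k b u + u.2.1 + 1, fun m hm => ?_⟩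
    rw [Function.iterate_succ_apply', Function.iterate_succ_apply', h m (by omega), ← hu]
    exact finiteStep_eq_of_lt k b α ε (by omega) (by omega)

theorem prefix_advance (s : ExpansionState) (a : ℕ) (x : Bool) :
    s.1 <+: (advance k b s a x).1 := by
  unfold advance
  split_ifs
  · exact List.prefix_append _ _
  · exact List.prefix_rfl

theorem prefix_iterate_oracleStep (s : ExpansionState) (t : ℕ) :
    s.1 <+: ((oracleStep k b α ε)^[t] s).1 := by
  induction t with
  | zero => exact List.prefix_rfl
  | succ t ih =>
    rw [Function.iterate_succ_apply']
    exact ih.trans (prefix_advance k b _ _ _)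

/-- If the digits produced with access to the full oracles are the first terms of `d`, and
arbitrarily many of them are produced, then the procedure produces `d`. -/
theorem producesDigits_of_oracle (x₀ : ℕ) (d : ℕ → ℕ)
    (hd : ∀ t i v, ((oracleStep k b α ε)^[t] (initialState x₀)).1[i]? = some v → v = d i)
    (hlen : ∀ i, ∃ t, i < ((oracleStep k b α ε)^[t] (initialState x₀)).1.length) :
    ProducesDigits (digitProcedure k b) α ε x₀ d := by
  intro i
  constructor
  · obtain ⟨T, hT⟩ := hlen i
    obtain ⟨m₀, hm⟩ := exists_forall_iterate_finiteStep_eq k b α ε (initialState x₀) T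
    -- The first `T` steps are genuine and already produce digit `i`; the other `m₀` may stall but
    -- only ever append digits.
    refine ⟨m₀ + T, ?_⟩
    have h1 := hm (m₀ + T) (by omega)
    obtain ⟨t', ht'⟩ := exists_iterate_finiteStep_eq k b α ε (m₀ + T)
      ((oracleStep k b α ε)^[T] (initialState x₀)) m₀
    have h2 : digitProcedure k b (seqPrefix α (m₀ + T), seqPrefix ε (m₀ + T), x₀, i)
        = ((oracleStep k b α ε)^[t'] ((oracleStep k b α ε)^[T] (initialState x₀))).1[i]? := by
      simp only [digitProcedure, length_seqPrefix]
      rw [Function.iterate_add_apply, h1, ht']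
    have h3 := prefix_iterate_oracleStep k b α ε ((oracleStep k b α ε)^[T] (initialState x₀)) t'
    have h4 := hT.trans_le h3.length_le
    have h5 := List.getElem?_eq_getElem h4
    rw [h2, h5]
    exact congrArg some (hd (t' + T) i _ (by rw [Function.iterate_add_apply]; exact h5))
  · intro m v hv
    simp only [digitProcedure] at hv
    obtain ⟨t', ht'⟩ := exists_iterate_finiteStep_eq k b α ε m (initialState x₀)
      (seqPrefix α m).length
    rw [ht'] at hv
    exact hd t' i v hv

end correctness

/-! ### The infinite expansion and its computation -/

/-- The lengths of the convergents, when the block after `n` digits has its leading one at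
position `rad n - 1`. -/
def convergentLength (rad : ℕ → ℕ) (x₀ : ℕ) : ℕ → ℕ
  | 0 => x₀ + 11
  | N + 1 => rad (convergentLength rad x₀ N) + rad (convergentLength rad x₀ N) + 2

theorem getElem?_eq_of_prefix {β : Type} {l₁ l₂ : List β} (h : l₁ <+: l₂) {i : ℕ}
    (hi : i < l₁.length) : l₁[i]? = l₂[i]? := by
  obtain ⟨t, rfl⟩ := h
  exact (List.getElem?_append_left hi).symm

section expansion

variable (k b : ℕ) (α : ℕ → ℕ) (rad : ℕ → ℕ) (x₀ : ℕ) (ε : ℕ → Bool)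

/-- The digits of the convergents. -/
def convergentDigits : ℕ → List ℕ
  | 0 => (initialState x₀).1
  | N + 1 => convergentDigits N ++
      digitBlock k b (convergentLength rad x₀ N) (rad (convergentLength rad x₀ N))
        (α (Nat.pair (b ^ (k * convergentLength rad x₀ N))
          (2 * b * rad (convergentLength rad x₀ N)))) (ε N)

/-- Stage `i + 1` has more than `i` digits as soon as `n < rad n` for `n ≥ x₀`, and then the default
0 is never used. -/
def limitDigit (i : ℕ) : ℕ := (convergentDigits k b α rad x₀ ε (i + 1)).getD i 0

variable {k b α rad x₀} (hrad : ∀ n, x₀ ≤ n → n < rad n)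
include hrad

theorem le_convergentLength (N : ℕ) : x₀ + 11 + N ≤ convergentLength rad x₀ N := by
  induction N with
  | zero => exact le_rfl
  | succ N ih =>
    have := hrad (convergentLength rad x₀ N) (by omega)
    rw [convergentLength]
    omega

theorem length_convergentDigits (N : ℕ) :
    (convergentDigits k b α rad x₀ ε N).length = convergentLength rad x₀ N := by
  induction N with
  | zero => simp [convergentDigits, initialState, convergentLength]
  | succ N ih =>
    have h1 := le_convergentLength hrad N
    have := hrad (convergentLength rad x₀ N) (by omega)
    rw [convergentDigits, List.length_append, ih, convergentLength]
    simp only [digitBlock, List.length_map, List.length_range]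
    omega

omit hrad in
theorem convergentDigits_prefix {M N : ℕ} (h : M ≤ N) :
    convergentDigits k b α rad x₀ ε M <+: convergentDigits k b α rad x₀ ε N := by
  induction N, h using Nat.le_induction with
  | base => exact List.prefix_rfl
  | succ N _ ih => exact ih.trans (List.prefix_append _ _)

theorem getElem?_convergentDigits {N i : ℕ} (h : i < convergentLength rad x₀ N) :
    (convergentDigits k b α rad x₀ ε N)[i]? = some (limitDigit k b α rad x₀ ε i) := by
  have h1 : i < (convergentDigits k b α rad x₀ ε N).length := by
    rwa [length_convergentDigits ε hrad]
  have h2 : i < (convergentDigits k b α rad x₀ ε (i + 1)).length := by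
    rw [length_convergentDigits ε hrad]
    have := le_convergentLength hrad (i + 1)
    omega
  have h3 : (convergentDigits k b α rad x₀ ε (i + 1))[i]?
      = some (limitDigit k b α rad x₀ ε i) := by
    rw [limitDigit, List.getD_eq_getElem _ _ h2, List.getElem?_eq_getElem h2]
  rcases le_total N (i + 1) with h | h
  · rw [getElem?_eq_of_prefix (convergentDigits_prefix ε h) h1, h3]
  · rw [← h3, getElem?_eq_of_prefix (convergentDigits_prefix ε h) h2]

theorem limitDigit_of_lt_zero {i : ℕ} (h : i < x₀ + 11) :
    limitDigit k b α rad x₀ ε i = if i = x₀ + 10 then 1 else 0 := by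
  have h1 := getElem?_convergentDigits (k := k) (b := b) (α := α) ε hrad (N := 0) (i := i)
    (by simpa [convergentLength] using h)
  simp only [convergentDigits, initialState, List.getElem?_map, List.getElem?_range h,
    Option.map_some, Option.some_inj] at h1
  exact h1.symm

theorem limitDigit_block {N i : ℕ} (h1 : convergentLength rad x₀ N ≤ i)
    (h2 : i < convergentLength rad x₀ (N + 1)) :
    limitDigit k b α rad x₀ ε i = blockDigit (rad (convergentLength rad x₀ N))
      (if AdmitsOnes k b (convergentLength rad x₀ N) (rad (convergentLength rad x₀ N))
        (α (Nat.pair (b ^ (k * convergentLength rad x₀ N))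
          (2 * b * rad (convergentLength rad x₀ N)))) then 1 else 0) (ε N).toNat i := by
  have h3 := getElem?_convergentDigits (k := k) (b := b) (α := α) ε hrad (N := N + 1) h2
  rw [convergentDigits, List.getElem?_append_right (by rwa [length_convergentDigits ε hrad]),
    length_convergentDigits ε hrad] at h3
  rw [convergentLength] at h2
  simp only [digitBlock, List.getElem?_map] at h3
  rw [List.getElem?_range (by omega)] at h3
  simp only [Option.map_some, Option.some_inj] at h3
  rw [← h3, Nat.add_sub_cancel' h1]

theorem limitDigit_le_one (i : ℕ) : limitDigit k b α rad x₀ ε i ≤ 1 := by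
  by_cases h : i < x₀ + 11
  · rw [limitDigit_of_lt_zero ε hrad h]
    split_ifs <;> omega
  · obtain ⟨N, h1, h2⟩ : ∃ N, convergentLength rad x₀ N ≤ i ∧
        i < convergentLength rad x₀ (N + 1) := by
      have hex : ∃ N, i < convergentLength rad x₀ (N + 1) :=
        ⟨i, by have := le_convergentLength hrad (i + 1); omega⟩
      refine ⟨Nat.find hex, ?_, Nat.find_spec hex⟩
      rcases Nat.eq_zero_or_pos (Nat.find hex) with h0 | h0
      · rw [h0, convergentLength]
        omega
      · have := Nat.find_min hex (m := Nat.find hex - 1) (by omega)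
        rw [Nat.sub_add_cancel h0] at this
        omega
    rw [limitDigit_block ε hrad h1 h2]
    exact blockDigit_le_one (by split_ifs <;> omega) (by cases ε N <;> simp) i

theorem limitDigit_eq_toNat (N : ℕ) :
    limitDigit k b α rad x₀ ε
      (rad (convergentLength rad x₀ N) + rad (convergentLength rad x₀ N)) = (ε N).toNat := by
  have h1 := le_convergentLength hrad N
  have h2 := hrad (convergentLength rad x₀ N) (by omega)
  rw [limitDigit_block ε hrad (N := N) (by omega) (by rw [convergentLength]; omega), blockDigit,
    if_neg (by omega), if_neg (by omega), if_neg (by omega), if_pos rfl]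

theorem limitDigit_last (N : ℕ) :
    limitDigit k b α rad x₀ ε (convergentLength rad x₀ N - 1) = 1 := by
  cases N with
  | zero =>
    rw [convergentLength, limitDigit_of_lt_zero ε hrad (by omega), if_pos (by omega)]
  | succ N =>
    have h1 := le_convergentLength hrad N
    have h2 := hrad (convergentLength rad x₀ N) (by omega)
    rw [convergentLength, limitDigit_block ε hrad (N := N) (by omega)
      (by rw [convergentLength]; omega), blockDigit,
      if_neg (by omega), if_neg (by omega), if_neg (by omega), if_neg (by omega)]

variable
  (hadm : ∀ n, Admissible k b n (rad n) (α (Nat.pair (b ^ (k * n)) (2 * b * rad n))))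
  (hmin : ∀ n r, r < rad n → ¬ Admissible k b n r (α (Nat.pair (b ^ (k * n)) (2 * b * r))))
include hadm hmin

omit hrad in
-- There are `rad D.length` failed tests, for `r` below the minimum, followed by one success.
theorem iterate_oracleStep_block (D : List ℕ) (N : ℕ) :
    (oracleStep k b α ε)^[rad D.length + 1] (D, N, 0) =
      (D ++ digitBlock k b D.length (rad D.length)
        (α (Nat.pair (b ^ (k * D.length)) (2 * b * rad D.length))) (ε N), N + 1, 0) := by
  have h : ∀ j, j ≤ rad D.length → (oracleStep k b α ε)^[j] (D, N, 0) = (D, N, j) := by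
    intro j
    induction j with
    | zero => intro; rfl
    | succ j ih =>
      intro hj
      rw [Function.iterate_succ_apply', ih (by omega), oracleStep, advance, query]
      exact if_neg (hmin D.length j (by omega))
  rw [Function.iterate_succ_apply', h _ le_rfl, oracleStep, advance, query]
  exact if_pos (hadm _)

theorem exists_iterate_oracleStep_eq (N : ℕ) :
    ∃ t, N ≤ t ∧ (oracleStep k b α ε)^[t] (initialState x₀) =
      (convergentDigits k b α rad x₀ ε N, N, 0) := by
  induction N with
  | zero => exact ⟨0, le_rfl, rfl⟩
  | succ N ih =>
    obtain ⟨t, h1, h2⟩ := ih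
    refine ⟨rad (convergentLength rad x₀ N) + 1 + t, by omega, ?_⟩
    have h3 := iterate_oracleStep_block ε hadm hmin
      (convergentDigits k b α rad x₀ ε N) N
    rw [length_convergentDigits ε hrad] at h3
    rw [Function.iterate_add_apply, h2, h3, convergentDigits]

theorem producesDigits_limitDigit :
    ProducesDigits (digitProcedure k b) α ε x₀ (limitDigit k b α rad x₀ ε) := by
  apply producesDigits_of_oracle
  · intro t i v hv
    -- A block may be unfinished after `t` steps in terms of tests; running on to the end of stage
    -- `t` gives a list that extends the present one.
    obtain ⟨t', h1, h2⟩ := exists_iterate_oracleStep_eq (x₀ := x₀) ε hrad hadm hmin t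
    obtain ⟨j, rfl⟩ := Nat.exists_eq_add_of_le' h1
    rw [Function.iterate_add_apply] at h2
    have h3 := prefix_iterate_oracleStep k b α ε ((oracleStep k b α ε)^[t] (initialState x₀)) j
    rw [h2] at h3
    obtain ⟨hi, -⟩ := List.getElem?_eq_some_iff.mp hv
    have h4 := getElem?_eq_of_prefix h3 hi
    have h5 : i < convergentLength rad x₀ t := by
      rw [← length_convergentDigits (k := k) (b := b) (α := α) ε hrad]
      exact hi.trans_le h3.length_le
    rw [hv, getElem?_convergentDigits ε hrad h5] at h4
    exact Option.some_inj.mp h4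
  · intro i
    obtain ⟨t, -, h2⟩ := exists_iterate_oracleStep_eq (x₀ := x₀) ε hrad hadm hmin i
    refine ⟨t, ?_⟩
    rw [h2]
    simp only
    rw [length_convergentDigits ε hrad]
    have := le_convergentLength hrad i
    omega

end expansion

/-! ### Assembling the theorem -/

theorem hasSharpConvergents_limitDigit {k b : ℕ} (hk : 2 ≤ k) (hb : 3 ≤ b) {Ψ : ℕ → ℝ} {x₀ : ℕ}
    {α rad : ℕ → ℕ} (hdec : HalfDecayFrom Ψ x₀) (hα : IsNameOf α Ψ)
    (hrad : ∀ n, x₀ ≤ n → 2 * k * n < rad n)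
    (hadm : ∀ n, Admissible k b n (rad n) (α (Nat.pair (b ^ (k * n)) (2 * b * rad n))))
    (hmin : ∀ n r, r < rad n → ¬ Admissible k b n r (α (Nat.pair (b ^ (k * n)) (2 * b * r))))
    (ε : ℕ → Bool) {d : ℕ → Fin b} (hd : ∀ i, (d i : ℕ) = limitDigit k b α rad x₀ ε i) :
    HasSharpConvergents k b Ψ (Real.ofDigits d) (convergentLength rad x₀)
      (fun N => rad (convergentLength rad x₀ N))
      (fun N => prefixNum b (fun i => (d i : ℕ)) (convergentLength rad x₀ N)) := by
  have hb' : (3 : ℝ) ≤ b := by exact_mod_cast hb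
  have hrad' : ∀ n, x₀ ≤ n → n < rad n := by
    intro n hn
    have h1 := hrad n hn
    have h2 : 1 * n ≤ 2 * k * n := Nat.mul_le_mul_right _ (by omega)
    omega
  have hd1 : ∀ i, (d i : ℕ) ≤ 1 := fun i => by
    rw [hd]
    exact limitDigit_le_one ε hrad' i
  have hlen : ∀ N, x₀ + 11 ≤ convergentLength rad x₀ N := fun N => by
    have := le_convergentLength hrad' N
    omega
  have est : ∀ N, _ := fun N => block_estimates (x := (ε N).toNat) hb hα hd1
    (hrad' (convergentLength rad x₀ N) (by have := hlen N; omega)) (hadm _)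
    (hmin _ _ (by have := hrad' (convergentLength rad x₀ N) (by have := hlen N; omega); omega))
    (fun i h1 h2 => (hd i).trans (limitDigit_block ε hrad' h1 h2)) rfl
  refine
    { le_n_zero := by have := hlen 0; omega
      decay := fun x hx hx' => hdec x hx ?_
      coprime := fun N => ?_
      n_succ := fun N => rfl
      lt_r := fun N => hrad _ (by have := hlen N; omega)
      lt_zeta := fun N => sub_pos.mp (est N).1
      tail_le := fun N => (est N).2.1
      tail_mul_le := fun N => (est N).2.2.1
      le_tail := fun N => (est N).2.2.2
      zeta_le := ?_ }
  · have h1 := hlen 0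
    have h2 : 1 * convergentLength rad x₀ 0 ≤ k * convergentLength rad x₀ 0 :=
      Nat.mul_le_mul_right _ (by omega)
    have h3 := Nat.lt_pow_self (n := k * convergentLength rad x₀ 0) (by omega : 1 < b)
    omega
  · have h1 := coprime_prefixNum_succ (b := b) (d := fun i => (d i : ℕ))
      (n := convergentLength rad x₀ N - 1) ((hd _).trans (limitDigit_last ε hrad' N))
    rwa [Nat.sub_add_cancel (by have := hlen N; omega)] at h1
  -- Two leading zeros already give `ζ ≤ 1 / ((b - 1) * b ^ 2)`.
  · have h1 := ofDigits_le_prefixNum_div hb hd1 2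
    have h2 : prefixNum b (fun i => (d i : ℕ)) 2 = 0 := by
      simp only [prefixNum, hd]
      rw [limitDigit_of_lt_zero ε hrad' (by omega), limitDigit_of_lt_zero ε hrad' (by omega),
        if_neg (by omega), if_neg (by omega)]
      simp
    rw [h2] at h1
    refine h1.trans ?_
    rw [Nat.cast_zero, zero_div, zero_add]
    apply one_div_le_one_div_of_le (by norm_num)
    nlinarith

/-- The procedure `digitProcedure k b` computes the digits of elements of both sets. -/
theorem exists_digits_mem_fractalExactSet {k b : ℕ} (hk : 2 ≤ k) (hb : 3 ≤ b) {Ψ : ℕ → ℝ}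
    {x₀ : ℕ} {α : ℕ → ℕ} (hΨ : PositiveOnPos Ψ) (hdec : HalfDecayFrom Ψ x₀) (hα : IsNameOf α Ψ) :
    ∃ d : (ℕ → Bool) → ℕ → Fin b,
      Function.Injective (fun ε => Real.ofDigits (d ε)) ∧
      ∀ ε : ℕ → Bool,
        ProducesDigits (digitProcedure k b) α ε x₀ (fun i => (d ε i : ℕ)) ∧
        Real.ofDigits (d ε) ∈ fractalExactSet b (approxSetStar k) Ψ ∧
        (SubMultiplicativeGrowth Ψ →
          Real.ofDigits (d ε) ∈ fractalExactSet b (approxSet k) Ψ) := by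
  have hex := exists_admissible (k := k) hb hΨ hα
  set rad : ℕ → ℕ := fun n => Nat.find (hex n) with hraddef
  have hadm : ∀ n, Admissible k b n (rad n) (α (Nat.pair (b ^ (k * n)) (2 * b * rad n))) :=
    fun n => Nat.find_spec (hex n)
  have hmin : ∀ n r, r < rad n →
      ¬ Admissible k b n r (α (Nat.pair (b ^ (k * n)) (2 * b * r))) :=
    fun n r h => Nat.find_min (hex n) h
  have hrad : ∀ n, x₀ ≤ n → 2 * k * n < rad n := by
    intro n hn
    refine lt_of_admissible hb (hα _ _ (by positivity)) (hadm n) (hdec _ (by positivity) ?_)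
    have h2 : 1 * n ≤ k * n := Nat.mul_le_mul_right _ (by omega)
    have h3 := Nat.lt_pow_self (n := k * n) (by omega : 1 < b)
    omega
  have hrad' : ∀ n, x₀ ≤ n → n < rad n := by
    intro n hn
    have h1 := hrad n hn
    have h2 : 1 * n ≤ 2 * k * n := Nat.mul_le_mul_right _ (by omega)
    omega
  have hd1 : ∀ ε i, limitDigit k b α rad x₀ ε i ≤ 1 := fun ε => limitDigit_le_one ε hrad'
  refine ⟨fun ε i => ⟨limitDigit k b α rad x₀ ε i, by have := hd1 ε i; omega⟩, ?_, fun ε => ?_⟩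
  · intro ε ε' h
    have h1 := ofDigits_injOn_le_one hb (fun i => hd1 ε i) (fun i => hd1 ε' i) h
    funext N
    -- As long as `ε` and `ε'` are arbitrary, the block positions are the same for both: `rad`
    -- depends only on `α`. So the free digit of block `N` recovers the `N`-th bit.
    have h2 := congrArg Fin.val (congrFun h1
      (rad (convergentLength rad x₀ N) + rad (convergentLength rad x₀ N)))
    simp only at h2
    rw [limitDigit_eq_toNat ε hrad', limitDigit_eq_toNat ε' hrad'] at h2
    revert h2
    cases ε N <;> cases ε' N <;> simp
  · have H := hasSharpConvergents_limitDigit hk hb hdec hα hrad hadm hmin ε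
      (d := fun i => ⟨limitDigit k b α rad x₀ ε i, by have := hd1 ε i; omega⟩) fun i => rfl
    have hmem : Real.ofDigits (b := b)
        (fun i => ⟨limitDigit k b α rad x₀ ε i, by have := hd1 ε i; omega⟩)
        ∈ missingDigitSet b {0, 1} := by
      refine ⟨_, fun i => ?_, rfl⟩
      have := hd1 ε i
      simp only [Set.mem_insert_iff, Set.mem_singleton_iff]
      omega
    refine ⟨producesDigits_limitDigit ε hrad' hadm hmin, ⟨⟨H.mem_approxSetStar hk hb, ?_⟩, hmem⟩,
      fun hg => ⟨⟨H.mem_approxSet hk hb, ?_⟩, hmem⟩⟩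
    · simp only [Set.mem_iUnion, not_exists]
      exact fun c hc => H.notMem_approxSetStar hk hb hΨ hc
    · simp only [Set.mem_iUnion, not_exists]
      exact fun c hc => H.notMem_approxSet hk hb hΨ hg hc

theorem exists_isNameOf {Ψ : ℕ → ℝ} (hΨ : PositiveOnPos Ψ) : ∃ α, IsNameOf α Ψ := by
  refine ⟨fun c => ⌊Ψ c.unpair.1 * 2 ^ c.unpair.2⌋₊, fun q m hq => ?_⟩
  simp only [Nat.unpair_pair]
  have h0 : 0 ≤ Ψ q * 2 ^ m := mul_nonneg (hΨ q hq).le (by positivity)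
  have h1 := Nat.floor_le h0
  have h2 := Nat.lt_floor_add_one (Ψ q * 2 ^ m)
  have e : Ψ q - (⌊Ψ q * 2 ^ m⌋₊ : ℝ) / 2 ^ m = (Ψ q * 2 ^ m - ⌊Ψ q * 2 ^ m⌋₊) / 2 ^ m := by
    field_simp
  rw [e, abs_of_nonneg (div_nonneg (by linarith) (by positivity))]
  gcongr
  linarith

/-- Cantor's diagonal argument on binary sequences. -/
theorem not_countable_of_injective_bool {S : Set ℝ} {f : (ℕ → Bool) → ℝ}
    (hf : Function.Injective f) (hS : ∀ ε, f ε ∈ S) : ¬ S.Countable := by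
  intro h
  have h1 : (Set.range f).Countable := h.mono (Set.range_subset_iff.mpr hS)
  have h2 : Countable (ℕ → Bool) := by
    have := h1.to_subtype
    exact (Set.rangeFactorization_injective.mpr hf).countable
  obtain ⟨g, hg⟩ := exists_surjective_nat (ℕ → Bool)
  obtain ⟨m, hm⟩ := hg fun i => !(g i i)
  have := congrFun hm m
  simp at this

theorem theorem9 (k b : ℕ) (hk : 2 ≤ k) (hb : 3 ≤ b) :
    -- the set is uncountable, for `𝒦_k`
    (∀ Ψ : ℕ → ℝ, PositiveOnPos Ψ → (∃ x₀ : ℕ, HalfDecayFrom Ψ x₀) → SubMultiplicativeGrowth Ψ →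
      ¬ (fractalExactSet b (approxSet k) Ψ).Countable) ∧
    -- the same for `𝒦_k^*`, without the growth condition
    (∀ Ψ : ℕ → ℝ, PositiveOnPos Ψ → (∃ x₀ : ℕ, HalfDecayFrom Ψ x₀) →
      ¬ (fractalExactSet b (approxSetStar k) Ψ).Countable) ∧
    -- effectivity: one algorithm, with `Ψ` (through approximations), `x₀` and an infinite binary
    -- sequence `ε` as input, computes the digits of elements, different for different `ε`
    (∃ F : List ℕ × List Bool × ℕ × ℕ → Option ℕ, Computable F ∧
      ∀ (Ψ : ℕ → ℝ) (x₀ : ℕ) (α : ℕ → ℕ),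
        PositiveOnPos Ψ → HalfDecayFrom Ψ x₀ → IsNameOf α Ψ →
        ∃ d : (ℕ → Bool) → ℕ → Fin b,
          Function.Injective (fun ε => Real.ofDigits (d ε)) ∧
          ∀ ε : ℕ → Bool,
            ProducesDigits F α ε x₀ (fun i => (d ε i : ℕ)) ∧
            Real.ofDigits (d ε) ∈ fractalExactSet b (approxSetStar k) Ψ ∧
            (SubMultiplicativeGrowth Ψ →
              Real.ofDigits (d ε) ∈ fractalExactSet b (approxSet k) Ψ)) := by
  refine ⟨fun Ψ hΨ ⟨x₀, hx₀⟩ hg => ?_, fun Ψ hΨ ⟨x₀, hx₀⟩ => ?_, digitProcedure k b,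
    computable_digitProcedure k b,
    fun Ψ x₀ α hΨ hx₀ hα => exists_digits_mem_fractalExactSet hk hb hΨ hx₀ hα⟩
  · obtain ⟨α, hα⟩ := exists_isNameOf hΨ
    obtain ⟨d, hinj, hd⟩ := exists_digits_mem_fractalExactSet hk hb hΨ hx₀ hα
    exact not_countable_of_injective_bool hinj fun ε => (hd ε).2.2 hg
  · obtain ⟨α, hα⟩ := exists_isNameOf hΨ
    obtain ⟨d, hinj, hd⟩ := exists_digits_mem_fractalExactSet hk hb hΨ hx₀ hα
    exact not_countable_of_injective_bool hinj fun ε => (hd ε).2.1
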